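/- By a graph we mean a finite multigraph, with loops and multiple edges allowed; connected graphs are non-empty. Let $p$ be a prime number ($p = 2$ is allowed). An unramified $\mathbb{Z}_p$-covering $X_\infty/X$ of connected graphs is a tower $X = X_0 \leftarrow X_1 \leftarrow X_2 \leftarrow \cdots$ of unramified coverings of connected graphs such that, for each $n \ge 0$, the composite $X_n \to X$ is a Galois covering with Galois group isomorphic to $\mathbb{Z}/p^n\mathbb{Z}$. Here a covering is unramified if it is surjective and maps the oriented edges starting at each vertex $w$ bijectively onto the oriented edges starting at the image of $w$; it is Galois if its group of deck transformations, which is then called its Galois group, acts transitively on each fibre. Let $\kappa_{X_n}$ be the number of spanning trees of $X_n$. Proposition. For any unramified $\mathbb{Z}_p$-covering $X_\infty/X$ of connected graphs, $\lambda(X_\infty/X)$ is odd. That is, there are integers $\lambda, \mu \geq 0$ and $\nu$ such that $$\operatorname{ord}_p(\kappa_{X_n}) = \lambda n + \mu p^n + \nu$$ for all sufficiently large $n$, and whenever this formula holds for all sufficiently large $n$ with some integers $\lambda, \mu \ge 0$ and $\nu$, the integer $\lambda = \lambda(X_\infty/X)$ is odd. -/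

import Mathlib

open Filter

/-- A finite multigraph (loops and multiple edges allowed) in Serre's formalism: every geometric
edge is represented by two opposite oriented edges `e` and `inv e`. -/
structure SerreGraph where
  /-- vertices -/
  V : Type*
  /-- oriented edges -/
  E : Type*
  [finite_V : Finite V]
  [finite_E : Finite E]
  /-- the opposite edge -/
  inv : E → E
  /-- source -/
  s : E → V
  /-- target -/
  t : E → V
  inv_inv : ∀ e, inv (inv e) = e
  inv_ne : ∀ e, inv e ≠ e
  s_inv : ∀ e, s (inv e) = t e
  t_inv : ∀ e, t (inv e) = s e

namespace SerreGraph

attribute [instance] SerreGraph.finite_V SerreGraph.finite_E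

/-- A graph is connected if it is non-empty and any two vertices are joined by a path. -/
def Connected (X : SerreGraph) : Prop :=
  Nonempty X.V ∧
    ∀ v w : X.V, Relation.ReflTransGen (fun a b => ∃ e : X.E, X.s e = a ∧ X.t e = b) v w

/-- A circuit of length `n ≥ 1`: an oriented closed path, indexed cyclically, through `n` distinct
vertices and not using an edge together with its opposite. A loop is a circuit of length one, and
two distinct parallel geometric edges form a circuit of length two. -/
def IsCircuit (X : SerreGraph) (n : ℕ) (c : ZMod n → X.E) : Prop :=
  (∀ i, X.t (c i) = X.s (c (i + 1))) ∧
    Function.Injective (fun i => X.s (c i)) ∧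
    ∀ i j, c i ≠ X.inv (c j)

/-- A tree is a connected graph without circuits. -/
def IsTree (X : SerreGraph) : Prop :=
  X.Connected ∧ ∀ n : ℕ, 0 < n → ∀ c : ZMod n → X.E, ¬ X.IsCircuit n c

/-- The subgraph with all the vertices of `X` and with a given set of edges closed under passing
to opposite edges. -/
def spanningSubgraph (X : SerreGraph) (T : Set X.E) (hT : ∀ e ∈ T, X.inv e ∈ T) : SerreGraph where
  V := X.V
  E := T
  inv e := ⟨X.inv e.1, hT e.1 e.2⟩
  s e := X.s e.1
  t e := X.t e.1
  inv_inv e := Subtype.ext (X.inv_inv e.1)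
  inv_ne e h := X.inv_ne e.1 (congrArg Subtype.val h)
  s_inv e := X.s_inv e.1
  t_inv e := X.t_inv e.1

/-- The edge sets of the spanning trees of `X`. -/
def spanningTrees (X : SerreGraph) : Set (Set X.E) :=
  {T | ∃ hT : ∀ e ∈ T, X.inv e ∈ T, (X.spanningSubgraph T hT).IsTree}

/-- The number of spanning trees of `X`. -/
noncomputable def numSpanningTrees (X : SerreGraph) : ℕ := X.spanningTrees.ncard

/-- Morphisms of graphs. -/
structure Hom (Y X : SerreGraph) where
  onV : Y.V → X.V
  onE : Y.E → X.E
  map_inv : ∀ e, onE (Y.inv e) = X.inv (onE e)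
  map_s : ∀ e, onV (Y.s e) = X.s (onE e)
  map_t : ∀ e, onV (Y.t e) = X.t (onE e)

/-- The identity morphism. -/
def Hom.id (X : SerreGraph) : Hom X X where
  onV v := v
  onE e := e
  map_inv _ := rfl
  map_s _ := rfl
  map_t _ := rfl

/-- Composition of morphisms. -/
def Hom.comp {Z Y X : SerreGraph} (f : Hom Y X) (g : Hom Z Y) : Hom Z X where
  onV v := f.onV (g.onV v)
  onE e := f.onE (g.onE e)
  map_inv e := by rw [g.map_inv, f.map_inv]
  map_s e := by rw [g.map_s, f.map_s]
  map_t e := by rw [g.map_t, f.map_t]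

/-- An unramified covering: a morphism, surjective on vertices, which for every vertex `w`
maps the edges starting at `w` bijectively onto the edges starting at the image of `w`. -/
def Hom.IsCovering {Y X : SerreGraph} (f : Hom Y X) : Prop :=
  Function.Surjective f.onV ∧
    ∀ w : Y.V, Set.BijOn f.onE {e | Y.s e = w} {e | X.s e = f.onV w}

/-- The group of deck transformations of `f : Y → X`, that is, of the automorphisms of the graph
`Y` over `X`, each given by its actions on vertices and on edges. -/
def Hom.deckGroup {Y X : SerreGraph} (f : Hom Y X) :
    Subgroup (Equiv.Perm Y.V × Equiv.Perm Y.E) where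
  carrier := {g | (∀ e, g.2 (Y.inv e) = Y.inv (g.2 e)) ∧ (∀ e, g.1 (Y.s e) = Y.s (g.2 e)) ∧
    (∀ e, g.1 (Y.t e) = Y.t (g.2 e)) ∧ (∀ v, f.onV (g.1 v) = f.onV v) ∧
    ∀ e, f.onE (g.2 e) = f.onE e}
  one_mem' := by simp
  mul_mem' := by
    rintro a b ⟨h1, h2, h3, h4, h5⟩ ⟨k1, k2, k3, k4, k5⟩
    refine ⟨?_, ?_, ?_, ?_, ?_⟩ <;> intro x <;> simp [*]
  inv_mem' := by
    rintro a ⟨h1, h2, h3, h4, h5⟩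
    refine ⟨fun e => ?_, fun e => ?_, fun e => ?_, fun v => ?_, fun e => ?_⟩
    · apply a.2.injective; simp [h1]
    · apply a.1.injective; simp [h2]
    · apply a.1.injective; simp [h3]
    · simpa using (h4 (a.1⁻¹ v)).symm
    · simpa using (h5 (a.2⁻¹ e)).symm

/-- A Galois covering of connected graphs: an unramified covering whose deck transformations act
transitively on every fibre. Its Galois group is `f.deckGroup`. -/
def Hom.IsGalois {Y X : SerreGraph} (f : Hom Y X) : Prop :=
  Y.Connected ∧ X.Connected ∧ f.IsCovering ∧
    ∀ w w' : Y.V, f.onV w = f.onV w' → ∃ g ∈ f.deckGroup, g.1 w = w'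

/-- The composite `X n → X (n - 1) → ⋯ → X 0` in a tower of graphs. -/
def towerToBase (X : ℕ → SerreGraph) (π : ∀ n, Hom (X (n + 1)) (X n)) : ∀ n, Hom (X n) (X 0)
  | 0 => Hom.id (X 0)
  | n + 1 => (towerToBase X π n).comp (π n)

end SerreGraph

/-- An unramified `ℤ_p`-covering of connected graphs: a tower `X 0 ← X 1 ← X 2 ← ⋯` of unramified
coverings of connected graphs such that each `X n → X 0` is Galois with Galois group isomorphic to
`ℤ / p ^ n`. -/
structure UnramifiedZpCovering (p : ℕ) where
  X : ℕ → SerreGraph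
  π : ∀ n, SerreGraph.Hom (X (n + 1)) (X n)
  connected : ∀ n, (X n).Connected
  isCovering : ∀ n, (π n).IsCovering
  isGalois : ∀ n, (SerreGraph.towerToBase X π n).IsGalois
  galoisGroup : ∀ n, Nonempty
    ((SerreGraph.towerToBase X π n).deckGroup ≃* Multiplicative (ZMod (p ^ n)))

/-- `l` and `m` are the Iwasawa `λ`- and `μ`-invariants of the tower: for some integer `ν`, the
`p`-adic valuation of the number of spanning trees of `X n` is `l * n + m * p ^ n + ν` for all
sufficiently large `n`. (For `p ≥ 2` at most one pair `(l, m)` has this property.) -/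
def UnramifiedZpCovering.HasIwasawaInvariants {p : ℕ} (T : UnramifiedZpCovering p)
    (l m : ℕ) : Prop :=
  ∃ ν : ℤ, ∀ᶠ n : ℕ in atTop,
    (padicValNat p (T.X n).numSpanningTrees : ℤ) = l * n + m * (p : ℤ) ^ n + ν

/-! The Laplacian of $X_n$ is singular, and by the matrix tree theorem the linear coefficient of its
characteristic polynomial is, up to sign, $|V(X_n)|\,\kappa_{X_n}$. Since $X_n \to X$ is cyclic,
this Laplacian is block circulant, so its characteristic polynomial is the product, over the
$p^n$-th roots of unity $\xi$, of those of the Laplacians of $X$ twisted by $\xi^{a(e)}$, with $a$ a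
voltage assignment. Comparing consecutive levels gives $p\,\kappa_{X_{k+1}} =
\kappa_{X_k}\prod_\zeta \det L_\zeta$ over the primitive $p^{k+1}$-th roots $\zeta$
(`numSpanningTrees_succ`).

Parity comes from edge reversal: $a(\bar e) = -a(e)$, so $T \mapsto T^{-1}$ transposes $L_T$, and
$\det L_T = h(T + T^{-1} - 2)$ for an integral polynomial $h$ (`exists_det_voltage_eq`). Moreover
$h(0) = 0$, since $L_1$ is singular, and $|\zeta + \zeta^{-1} - 2| = |\zeta - 1|^2$. If $p^\mu$ is
the exact power of $p$ dividing $h$ and $j_0$ is the first index where it is attained, then for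
large $k$ the product has valuation $\varphi(p^{k+1})\mu + 2j_0$ (`norm_aeval_eq_of_dominant`). The
factor $p$ on the left subtracts one, so $\lambda = 2j_0 - 1$ with $j_0 > 0$.

An integral voltage is available only up to a chosen level $m$, so $h = h_m$ varies. In place of a
$\mathbb{Z}_p$-valued voltage, compactness of $\mathbb{Z}_p^{\mathbb{N}}$ supplies a cluster point
$x$ of the coefficient sequences, and $\mu$, $j_0$ are read off from $x$. -/

/-! ### Spanning trees as rooted parent functions -/

/-- Take for `d` the length of a shortest path to `r`; the default value of `sInf ∅` only affects
points that do not reach `r`. -/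
theorem Relation.ReflTransGen.exists_rank {α : Type*} (R : α → α → Prop) (r : α) :
    ∃ d : α → ℕ, ∀ x, Relation.ReflTransGen R x r → x ≠ r →
      ∃ y, R x y ∧ Relation.ReflTransGen R y r ∧ d y < d x := by
  classical
  let P : ℕ → α → Prop := fun n => Nat.rec (fun x => x = r) (fun _ Q x => ∃ y, R x y ∧ Q y) n
  have hP : ∀ n x, P n x → Relation.ReflTransGen R x r := by
    intro n
    induction n with
    | zero => intro x hx; rw [show x = r from hx]
    | succ n ih =>
      rintro x ⟨y, hxy, hy⟩
      exact Relation.ReflTransGen.head hxy (ih y hy)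
  have hex : ∀ x, Relation.ReflTransGen R x r → ∃ n, P n x := by
    intro x hx
    induction hx using Relation.ReflTransGen.head_induction_on with
    | refl => exact ⟨0, rfl⟩
    | head hab _ ih => obtain ⟨n, hn⟩ := ih; exact ⟨n + 1, _, hab, hn⟩
  refine ⟨fun x => sInf {n | P n x}, fun x hx hxr => ?_⟩
  have hmem : P (sInf {n | P n x}) x := Nat.sInf_mem (hex x hx)
  change ∃ y, R x y ∧ Relation.ReflTransGen R y r ∧ sInf {n | P n y} < sInf {n | P n x}
  generalize sInf {n | P n x} = N at hmem
  cases N with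
  | zero => exact absurd hmem hxr
  | succ n =>
    obtain ⟨y, hxy, hy⟩ := hmem
    exact ⟨y, hxy, hP n y hy, Nat.lt_succ_of_le (Nat.sInf_le hy)⟩

namespace SerreGraph

/-- An infinite walk without backtracking contains a circuit. -/
theorem exists_isCircuit_of_walk (X : SerreGraph) (c : ℕ → X.E)
    (hc : ∀ k, X.t (c k) = X.s (c (k + 1))) (hb : ∀ k, c (k + 1) ≠ X.inv (c k)) :
    ∃ n, 0 < n ∧ ∃ c' : ZMod n → X.E, X.IsCircuit n c' := by
  classical
  have hex : ∃ n, 0 < n ∧ ∃ i, X.s (c i) = X.s (c (i + n)) := by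
    obtain ⟨a, b, hab, h⟩ := Finite.exists_ne_map_eq_of_infinite (fun k => X.s (c k))
    rcases lt_or_gt_of_ne hab with hlt | hlt
    · exact ⟨b - a, by omega, a, by rw [Nat.add_sub_cancel' hlt.le]; exact h⟩
    · exact ⟨a - b, by omega, b, by rw [Nat.add_sub_cancel' hlt.le]; exact h.symm⟩
  -- The least gap between two visits to one vertex: minimality makes the vertices of the closed
  -- piece distinct.
  obtain ⟨hn, i, hi⟩ := Nat.find_spec hex
  have hmin : ∀ m, m < Nat.find hex → 0 < m → ∀ j, X.s (c j) ≠ X.s (c (j + m)) :=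
    fun m hm h0 j hj => Nat.find_min hex hm ⟨h0, j, hj⟩
  generalize Nat.find hex = n at hn hi hmin
  have : NeZero n := ⟨hn.ne'⟩
  have hval : ∀ k : ZMod n, (k.val + 1 < n ∧ (k + 1).val = k.val + 1) ∨
      (k.val + 1 = n ∧ (k + 1).val = 0) := by
    intro k
    have h1 : (k + 1).val = (k.val + 1) % n := by
      rw [ZMod.val_add, ZMod.val_one_eq_one_mod, Nat.add_mod_mod]
    have h2 := ZMod.val_lt k
    rcases Nat.lt_or_ge (k.val + 1) n with h | h
    · exact Or.inl ⟨h, by rw [h1, Nat.mod_eq_of_lt h]⟩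
    · have h3 : k.val + 1 = n := by omega
      exact Or.inr ⟨h3, by rw [h1, h3, Nat.mod_self]⟩
  have hclosed : ∀ k : ZMod n, X.t (c (i + k.val)) = X.s (c (i + (k + 1).val)) := by
    intro k
    rw [hc]
    rcases hval k with ⟨_, h⟩ | ⟨h', h⟩
    · rw [h]; rfl
    · rw [h, add_assoc, h', ← hi]; rfl
  have hinj : Function.Injective (fun k : ZMod n => X.s (c (i + k.val))) := by
    have key : ∀ k l : ZMod n, k.val < l.val → X.s (c (i + k.val)) ≠ X.s (c (i + l.val)) := by
      intro k l hkl
      have := hmin (l.val - k.val) (by have := ZMod.val_lt l; omega) (by omega) (i + k.val)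
      rwa [show i + k.val + (l.val - k.val) = i + l.val by omega] at this
    intro k l hkl
    apply ZMod.val_injective n
    rcases lt_trichotomy k.val l.val with h | h | h
    · exact absurd hkl (key k l h)
    · exact h
    · exact absurd hkl.symm (key l k h)
  refine ⟨n, hn, fun k => c (i + k.val), hclosed, hinj, ?_⟩
  intro k l h
  replace h : c (i + k.val) = X.inv (c (i + l.val)) := h
  have hk : k = l + 1 := hinj (by
    change X.s (c (i + k.val)) = X.s (c (i + (l + 1).val))
    rw [← hclosed l, ← X.s_inv, ← h])
  have hl : l = k + 1 := hinj (by
    change X.s (c (i + l.val)) = X.s (c (i + (k + 1).val))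
    rw [← hclosed k, ← X.t_inv, ← h])
  have h' : c (i + l.val) = X.inv (c (i + k.val)) := by rw [← X.inv_inv (c (i + l.val)), ← h]
  -- Now `k` and `l` are cyclic successors of each other: either the walk backtracks, or `k = l` and
  -- an edge is its own opposite.
  rcases hval l with ⟨_, h1⟩ | ⟨h2, h1⟩
  · rw [← hk] at h1
    rw [h1] at h
    exact hb _ h
  · rcases hval k with ⟨_, h3⟩ | ⟨h4, h3⟩
    · rw [← hl] at h3
      rw [h3] at h'
      exact hb _ h'
    · have : k.val = l.val := by omega
      rw [this] at h
      exact X.inv_ne _ h.symm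

/-- An edge that can be bypassed lies on a circuit. -/
theorem exists_isCircuit_of_bypass (X : SerreGraph) (e : X.E)
    (h : Relation.ReflTransGen (fun a b => ∃ ε, ε ≠ e ∧ ε ≠ X.inv e ∧ X.s ε = a ∧ X.t ε = b)
      (X.t e) (X.s e)) :
    ∃ n, 0 < n ∧ ∃ c' : ZMod n → X.E, X.IsCircuit n c' := by
  set R : X.V → X.V → Prop := fun a b => ∃ ε, ε ≠ e ∧ ε ≠ X.inv e ∧ X.s ε = a ∧ X.t ε = b with hR
  obtain ⟨d, hd⟩ := Relation.ReflTransGen.exists_rank R (X.s e)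
  -- The walk crosses `e`, returns to its source along edges that decrease `d`, and repeats; it
  -- never backtracks.
  let I : X.E → Prop := fun ε => Relation.ReflTransGen R (X.t ε) (X.s e) ∧
    (ε = e ∨ (ε ≠ e ∧ ε ≠ X.inv e ∧ d (X.t ε) < d (X.s ε)))
  have step : ∀ ε : {ε // I ε}, ∃ ε' : {ε // I ε}, X.t ε.1 = X.s ε'.1 ∧ ε'.1 ≠ X.inv ε.1 := by
    rintro ⟨ε, hε, hor⟩
    by_cases hs : X.t ε = X.s e
    · refine ⟨⟨e, h, Or.inl rfl⟩, hs, ?_⟩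
      rcases hor with rfl | ⟨_, h2, _⟩
      · exact (X.inv_ne _).symm
      · intro (h3 : e = X.inv ε)
        exact h2 (by rw [h3, X.inv_inv])
    · obtain ⟨y, ⟨ε', h1, h2, h3, h4⟩, hy, hlt⟩ := hd _ hε hs
      refine ⟨⟨ε', by rw [h4]; exact hy, Or.inr ⟨h1, h2, by rw [h3, h4]; exact hlt⟩⟩, h3.symm, ?_⟩
      rintro rfl
      rcases hor with rfl | ⟨_, _, h5⟩
      · exact h2 rfl
      · rw [X.t_inv] at h4
        rw [← h4] at hlt
        exact lt_asymm hlt h5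
  choose nxt hn1 hn2 using step
  let c : ℕ → {ε // I ε} := fun k => nxt^[k] ⟨e, h, Or.inl rfl⟩
  have hcs : ∀ k, c (k + 1) = nxt (c k) := fun k => Function.iterate_succ_apply' nxt k _
  refine X.exists_isCircuit_of_walk (fun k => (c k).1) (fun k => ?_) (fun k => ?_)
  · rw [hcs]; exact hn1 _
  · rw [hcs]; exact hn2 _

/-- A choice, at every vertex other than the root `r`, of an edge leaving it. -/
abbrev ParentFun (X : SerreGraph) (r : X.V) := ∀ v : {v : X.V // v ≠ r}, {e : X.E // X.s e = v.1}

end SerreGraph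

/-- A map from the vertices other than `r` to all vertices is rooted if iterating it always leads
to `r`. -/
def IsRooted {V : Type*} {r : V} (φ : {v : V // v ≠ r} → V) : Prop :=
  ∃ d : V → ℕ, ∀ v, d (φ v) < d v.1

namespace SerreGraph

variable {X : SerreGraph} {r : X.V}

theorem ParentFun.val_congr (f : X.ParentFun r) {v w : {v : X.V // v ≠ r}} (h : v.1 = w.1) :
    (f v).1 = (f w).1 := by
  rw [Subtype.ext h]

/-- The geometric edges chosen by a parent function. -/
def ParentFun.edges (f : X.ParentFun r) : Set X.E := {e | ∃ v, e = (f v).1 ∨ e = X.inv (f v).1}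

theorem ParentFun.inv_mem_edges (f : X.ParentFun r) : ∀ e ∈ f.edges, X.inv e ∈ f.edges := by
  rintro e ⟨v, rfl | rfl⟩
  · exact ⟨v, Or.inr rfl⟩
  · exact ⟨v, Or.inl (X.inv_inv _)⟩

/-- A parent function is rooted if following the chosen edges always leads to the root. -/
def ParentFun.Rooted (f : X.ParentFun r) : Prop := IsRooted fun v => X.t (f v).1

theorem ParentFun.Rooted.reflTransGen {f : X.ParentFun r} (hf : f.Rooted) (v w : X.V) :
    Relation.ReflTransGen (fun a b => ∃ e ∈ f.edges, X.s e = a ∧ X.t e = b) v w := by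
  obtain ⟨d, hd⟩ := hf
  have key : ∀ n v, d v = n →
      Relation.ReflTransGen (fun a b => ∃ e ∈ f.edges, X.s e = a ∧ X.t e = b) v r := by
    intro n
    induction n using Nat.strong_induction_on with
    | _ n ih =>
      intro v hv
      by_cases hr : v = r
      · rw [hr]
      · refine Relation.ReflTransGen.head ⟨(f ⟨v, hr⟩).1, ⟨_, Or.inl rfl⟩, (f ⟨v, hr⟩).2, rfl⟩
          (ih _ ?_ _ rfl)
        rw [← hv]
        exact hd ⟨v, hr⟩
  refine (key _ v rfl).trans ?_
  have hsymm : Std.Symm (fun a b => ∃ e ∈ f.edges, X.s e = a ∧ X.t e = b) := by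
    constructor
    rintro a b ⟨e, he, h1, h2⟩
    exact ⟨X.inv e, f.inv_mem_edges e he, by rw [X.s_inv, h2], by rw [X.t_inv, h1]⟩
  exact Relation.ReflTransGen.stdSymm.symm _ _ (key _ w rfl)

theorem spanningSubgraph_connected_iff {T : Set X.E} (hT : ∀ e ∈ T, X.inv e ∈ T) :
    (X.spanningSubgraph T hT).Connected ↔ Nonempty X.V ∧ ∀ v w : X.V,
      Relation.ReflTransGen (fun a b => ∃ e ∈ T, X.s e = a ∧ X.t e = b) v w := by
  have : (fun a b => ∃ e : (X.spanningSubgraph T hT).E, (X.spanningSubgraph T hT).s e = a ∧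
      (X.spanningSubgraph T hT).t e = b) = fun a b => ∃ e ∈ T, X.s e = a ∧ X.t e = b := by
    funext a b
    exact propext ⟨fun ⟨e, h⟩ => ⟨e.1, e.2, h⟩, fun ⟨e, he, h⟩ => ⟨⟨e, he⟩, h⟩⟩
  unfold Connected
  rw [this]
  rfl

/-- At a vertex of a circuit with maximal `d`, the outgoing edge and the opposite of the incoming
edge are both the parent edge, which a circuit forbids. -/
theorem ParentFun.Rooted.isTree {f : X.ParentFun r} (hf : f.Rooted) :
    (X.spanningSubgraph f.edges f.inv_mem_edges).IsTree := by
  refine ⟨(spanningSubgraph_connected_iff _).2 ⟨⟨r⟩, hf.reflTransGen⟩, ?_⟩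
  obtain ⟨d, hd⟩ := hf
  rintro n hn c ⟨h1, -, h3⟩
  have : NeZero n := ⟨hn.ne'⟩
  have h1' : ∀ i, X.t (c i).1 = X.s (c (i + 1)).1 := h1
  have h3' : ∀ i j, (c i).1 ≠ X.inv (c j).1 := fun i j h => h3 i j (Subtype.ext h)
  have hcase : ∀ e ∈ f.edges, (d (X.t e) < d (X.s e) ∧ ∃ h, e = (f ⟨X.s e, h⟩).1) ∨
      (d (X.s e) < d (X.t e) ∧ ∃ h, X.inv e = (f ⟨X.t e, h⟩).1) := by
    rintro e ⟨v, rfl | rfl⟩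
    · have hs : X.s (f v).1 = v.1 := (f v).2
      refine Or.inl ⟨by rw [hs]; exact hd v, by rw [hs]; exact v.2, ?_⟩
      exact f.val_congr hs.symm
    · have hs : X.s (f v).1 = v.1 := (f v).2
      refine Or.inr ⟨by rw [X.s_inv, X.t_inv, hs]; exact hd v, by rw [X.t_inv, hs]; exact v.2, ?_⟩
      rw [X.inv_inv]
      exact f.val_congr (hs.symm.trans (X.t_inv _).symm)
  obtain ⟨i, hi⟩ := Finite.exists_max (fun i : ZMod n => d (X.s (c i).1))
  have hprev : X.t (c (i - 1)).1 = X.s (c i).1 := by rw [h1', sub_add_cancel]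
  rcases hcase _ (c i).2 with ⟨_, hne, he⟩ | ⟨hlt, _⟩
  · rcases hcase _ (c (i - 1)).2 with ⟨hlt, _⟩ | ⟨_, hne', he'⟩
    · have := hi (i - 1)
      rw [hprev] at hlt
      omega
    · apply h3' i (i - 1)
      rw [he', he]
      exact f.val_congr hprev.symm
  · have := hi (i + 1)
    simp only [← h1'] at this
    omega

/-- Induction on `d`: if `f v` were opposite to `g u`, then `u` has smaller rank, so `f u = g u`
ends at `v`, and the rank would rise along `f`. -/
theorem ParentFun.Rooted.eq_of_edges_eq {f g : X.ParentFun r} (hf : f.Rooted)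
    (h : f.edges = g.edges) : f = g := by
  obtain ⟨d, hd⟩ := hf
  have key : ∀ n (v : {v : X.V // v ≠ r}), d v.1 = n → f v = g v := by
    intro n
    induction n using Nat.strong_induction_on with
    | _ n ih =>
      intro v hv
      have hmem : (f v).1 ∈ g.edges := h ▸ ⟨v, Or.inl rfl⟩
      obtain ⟨u, hu | hu⟩ := hmem
      · have : v = u := Subtype.ext (by rw [← (f v).2, hu, (g u).2])
        subst this
        exact Subtype.ext hu
      · have htu : X.t (f v).1 = u.1 := by rw [hu, X.t_inv, (g u).2]
        have h1 : d (X.t (f v).1) < d v.1 := hd v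
        rw [htu] at h1
        have h2 := ih _ (hv ▸ h1) u rfl
        have h3 : d (X.t (f u).1) < d u.1 := hd u
        rw [h2, ← X.s_inv, ← hu, (f v).2] at h3
        omega
  exact funext fun v => key _ v rfl

theorem exists_rooted_of_connected (T : Set X.E)
    (h : ∀ v, Relation.ReflTransGen (fun a b => ∃ e ∈ T, X.s e = a ∧ X.t e = b) v r) :
    ∃ f : X.ParentFun r, f.Rooted ∧ ∀ v, (f v).1 ∈ T := by
  obtain ⟨d, hd⟩ := Relation.ReflTransGen.exists_rank
    (fun a b => ∃ e ∈ T, X.s e = a ∧ X.t e = b) r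
  have : ∀ v : {v : X.V // v ≠ r}, ∃ e : {e : X.E // X.s e = v.1}, e.1 ∈ T ∧
      d (X.t e.1) < d v.1 := by
    intro v
    obtain ⟨y, ⟨e, he, h1, h2⟩, _, hlt⟩ := hd v.1 (h v.1) v.2
    exact ⟨⟨e, h1⟩, he, by rw [h2]; exact hlt⟩
  choose f hf1 hf2 using this
  exact ⟨f, ⟨d, hf2⟩, hf1⟩

theorem bijOn_edges (X : SerreGraph) (r : X.V) :
    Set.BijOn ParentFun.edges {f : X.ParentFun r | f.Rooted} X.spanningTrees := by
  refine ⟨fun f hf => ⟨f.inv_mem_edges, ParentFun.Rooted.isTree hf⟩,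
    fun f hf g _ h => ParentFun.Rooted.eq_of_edges_eq hf h, ?_⟩
  rintro T ⟨hT, hconn, hcirc⟩
  have hconn' := (spanningSubgraph_connected_iff hT).1 hconn
  obtain ⟨f, hf, hfT⟩ := exists_rooted_of_connected T fun v => hconn'.2 v r
  have hsub : f.edges ⊆ T := by
    rintro e ⟨v, rfl | rfl⟩
    · exact hfT v
    · exact hT _ (hfT v)
  refine ⟨f, hf, hsub.antisymm fun e he => ?_⟩
  by_contra hne
  -- An edge of `T` outside `f.edges` is bypassed within `f.edges`, so it would lie on a circuit.
  have hbyp := exists_isCircuit_of_bypass (X.spanningSubgraph T hT) ⟨e, he⟩ <| by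
    refine Relation.ReflTransGen.mono (fun a b hab => ?_) _ _ (hf.reflTransGen (X.t e) (X.s e))
    obtain ⟨ε, hε, h1, h2⟩ := hab
    refine ⟨⟨ε, hsub hε⟩, ?_, ?_, h1, h2⟩
    · rintro h
      exact hne (by rw [← show ε = e from congrArg Subtype.val h]; exact hε)
    · intro h
      have h' : ε = X.inv e := congrArg Subtype.val h
      exact hne (by rw [← X.inv_inv e, ← h']; exact f.inv_mem_edges _ hε)
  obtain ⟨n, hn, c, hc⟩ := hbyp
  exact hcirc n hn c hc

theorem numSpanningTrees_eq (X : SerreGraph) (r : X.V) :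
    X.numSpanningTrees = {f : X.ParentFun r | f.Rooted}.ncard := by
  unfold numSpanningTrees
  rw [← (X.bijOn_edges r).image_eq, (X.bijOn_edges r).injOn.ncard_image]

theorem numSpanningTrees_pos {X : SerreGraph} (h : X.Connected) : 0 < X.numSpanningTrees := by
  obtain ⟨⟨r⟩, h⟩ := h
  rw [X.numSpanningTrees_eq r, Set.ncard_pos]
  obtain ⟨f, hf, -⟩ := exists_rooted_of_connected (X := X) (r := r) Set.univ (by simpa using (h · r))
  exact ⟨f, hf⟩

end SerreGraph

/-! ### Matrix tree theorem -/

/-- For rooted `φ` the rank makes the matrix block triangular with identity diagonal blocks.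
Otherwise the indicator of the vertices that never reach `r` lies in the kernel. -/
theorem det_parentMatrix {V : Type*} [Fintype V] [DecidableEq V] {r : V}
    (φ : {v : V // v ≠ r} → V) [Decidable (IsRooted φ)] :
    (Matrix.of fun v v' : {v : V // v ≠ r} =>
      ((if v = v' then 1 else 0) - if φ v = v'.1 then 1 else 0 : ℤ)).det =
      if IsRooted φ then 1 else 0 := by
  split_ifs with h
  · obtain ⟨d, hd⟩ := h
    have htri : (Matrix.of fun v v' : {v : V // v ≠ r} =>
        ((if v = v' then 1 else 0) - if φ v = v'.1 then 1 else 0 : ℤ)).BlockTriangular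
        (fun v => OrderDual.toDual (d v.1)) := by
      intro v v' hlt
      have hlt' : d v.1 < d v'.1 := hlt
      have h1 : v ≠ v' := by rintro rfl; exact lt_irrefl _ hlt'
      have h2 : φ v ≠ v'.1 := by
        intro h
        have := hd v
        rw [h] at this
        omega
      simp [h1, h2]
    rw [htri.det]
    refine Finset.prod_eq_one fun a _ => ?_
    refine Eq.trans (congrArg Matrix.det ?_) Matrix.det_one
    ext ⟨v, hv⟩ ⟨v', hv'⟩
    have h2 : φ v ≠ v'.1 := by
      intro h
      have := hd v
      have hvv : OrderDual.toDual (d v.1) = OrderDual.toDual (d v'.1) := hv.trans hv'.symm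
      rw [h, OrderDual.toDual_inj.1 hvv] at this
      omega
    simp [Matrix.toSquareBlock, Matrix.toSquareBlockProp, h2, Matrix.one_apply]
  · let g : V → V := fun v => if h : v ≠ r then φ ⟨v, h⟩ else r
    have hg : ∀ v : {v : V // v ≠ r}, g v.1 = φ v := fun v => dif_pos v.2
    let S : Set V := {v | ∃ n, g^[n] v = r}
    have hS : ∀ v, v ≠ r → (g v ∈ S ↔ v ∈ S) := by
      intro v hv
      constructor
      · rintro ⟨n, hn⟩
        exact ⟨n + 1, hn⟩
      · rintro ⟨n, hn⟩
        cases n with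
        | zero => exact absurd hn hv
        | succ n => exact ⟨n, hn⟩
    have hr : r ∈ S := ⟨0, rfl⟩
    have hex : ∃ v, v ∉ S := by
      by_contra! hall
      classical
      refine h ⟨fun v => Nat.find (hall v), fun v => ?_⟩
      change Nat.find (hall (φ v)) < Nat.find (hall v.1)
      rw [Nat.find_lt_iff]
      have hspec := Nat.find_spec (hall v.1)
      generalize Nat.find (hall v.1) = n at hspec
      cases n with
      | zero => exact absurd hspec v.2
      | succ n => exact ⟨n, Nat.lt_succ_self n, by rw [← hg]; exact hspec⟩
    obtain ⟨u, hu⟩ := hex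
    classical
    rw [← Matrix.exists_mulVec_eq_zero_iff]
    refine ⟨fun v => if v.1 ∈ S then 0 else 1, fun h0 => ?_, ?_⟩
    · have := congrFun h0 ⟨u, by rintro rfl; exact hu hr⟩
      simp [hu] at this
    · funext v
      have h1 : ∑ v' : {v : V // v ≠ r}, (if φ v = v'.1 then (1 : ℤ) else 0) *
          (if v'.1 ∈ S then 0 else 1) = if φ v ∈ S then 0 else 1 := by
        by_cases hφ : φ v = r
        · rw [hφ, if_pos hr]
          refine Finset.sum_eq_zero fun v' _ => ?_
          rw [if_neg v'.2.symm, zero_mul]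
        · rw [Finset.sum_eq_single ⟨φ v, hφ⟩]
          · simp
          · intro b _ hb
            rw [if_neg, zero_mul]
            intro h
            exact hb (Subtype.ext h.symm)
          · simp
      simp only [Matrix.mulVec, dotProduct, Matrix.of_apply, sub_mul, Finset.sum_sub_distrib, h1,
        Pi.zero_apply]
      rw [Finset.sum_eq_single v (fun b _ hb => by rw [if_neg hb.symm, zero_mul]) (by simp),
        ← hg]
      simp [hS v.1 v.2]

/-- The Laplacian of a directed multigraph with source map `s`, target map `t` and edge
weights `w`; the degree part is not weighted. -/
def weightedLaplacian {V E R : Type*} [Fintype E] [DecidableEq V] [CommRing R] (s t : E → V)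
    (w : E → R) : Matrix V V R :=
  Matrix.of fun v v' => ∑ e, if s e = v then
    ((if v = v' then 1 else 0) - if t e = v' then w e else 0) else 0

section weightedLaplacian

variable {V E R S : Type*} [Fintype E] [DecidableEq V] [CommRing R] [CommRing S] (s t : E → V)

theorem weightedLaplacian_map (w : E → R) (f : R →+* S) :
    (weightedLaplacian s t w).map f = weightedLaplacian s t fun e => f (w e) := by
  ext v v'
  simp only [weightedLaplacian, Matrix.map_apply, Matrix.of_apply, map_sum, apply_ite f, map_sub,
    map_zero, map_one]

theorem weightedLaplacian_one_mulVec_one [Fintype V] :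
    (weightedLaplacian s t (fun _ => (1 : R))).mulVec 1 = 0 := by
  funext v
  simp only [weightedLaplacian, Matrix.mulVec, dotProduct, Matrix.of_apply, Pi.one_apply, mul_one,
    Pi.zero_apply]
  rw [Finset.sum_comm]
  refine Finset.sum_eq_zero fun e _ => ?_
  split_ifs <;> simp

theorem weightedLaplacian_one_det [Fintype V] [Nonempty V] [IsDomain R] :
    (weightedLaplacian s t (fun _ => (1 : R))).det = 0 :=
  Matrix.exists_mulVec_eq_zero_iff.1 ⟨1, one_ne_zero, weightedLaplacian_one_mulVec_one s t⟩

end weightedLaplacian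

namespace SerreGraph

/-- Kirchhoff's matrix tree theorem. -/
theorem det_minor_laplacian (X : SerreGraph) [Fintype X.V] [DecidableEq X.V] [Fintype X.E]
    (r : X.V) :
    ((weightedLaplacian X.s X.t (fun _ => (1 : ℤ))).submatrix
      (Subtype.val : {v // v ≠ r} → X.V) Subtype.val).det = X.numSpanningTrees := by
  classical
  -- Each row is a sum over the edges leaving its vertex, so multilinearity expands the minor over
  -- all parent functions.
  have hrow : (weightedLaplacian X.s X.t (fun _ => (1 : ℤ))).submatrix
      (Subtype.val : {v // v ≠ r} → X.V) Subtype.val =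
      fun v => ∑ e : {e // X.s e = v.1}, fun v' : {v // v ≠ r} =>
        ((if v = v' then 1 else 0) - if X.t e.1 = v'.1 then 1 else 0 : ℤ) := by
    funext v v'
    rw [Finset.sum_apply]
    simp only [weightedLaplacian, Matrix.submatrix_apply, Matrix.of_apply, Subtype.ext_iff]
    rw [← Finset.sum_filter]
    exact Finset.sum_subtype _ (by simp) _
  have hexp := (Matrix.detRowAlternating (R := ℤ) (n := {v : X.V // v ≠ r})).toMultilinearMap.map_sum
    (fun (v : {v : X.V // v ≠ r}) (e : {e // X.s e = v.1}) (v' : {v // v ≠ r}) =>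
        ((if v = v' then 1 else 0) - if X.t e.1 = v'.1 then 1 else 0 : ℤ))
  rw [hrow]
  refine hexp.trans ?_
  rw [X.numSpanningTrees_eq r, Set.ncard_eq_toFinset_card', Finset.card_eq_sum_ones,
    Nat.cast_sum, Set.toFinset_ofPred, Finset.sum_filter]
  refine Finset.sum_congr rfl fun f _ => ?_
  refine (det_parentMatrix (fun v => X.t (f v).1)).trans ?_
  rw [Nat.cast_one]
  rfl

end SerreGraph

theorem coeff_one_charpoly_neg {V R : Type*} [Fintype V] [DecidableEq V] [Nonempty V] [CommRing R]
    (M : Matrix V V R) :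
    (-M).charpoly.coeff 1 =
      ∑ r, (M.submatrix (Subtype.val : {v // v ≠ r} → V) Subtype.val).det := by
  have hc : 0 < Fintype.card V := Fintype.card_pos
  have h := Matrix.charpoly_coeff_eq_sum_minors (-M) (Fintype.card V - 1) (Nat.sub_le _ _)
  rw [Nat.sub_sub_self hc] at h
  rw [h, Finset.mul_sum]
  symm
  refine Finset.sum_bij (fun r _ => {r}ᶜ) ?_ ?_ ?_ ?_
  · intro r _
    simp [Finset.mem_powersetCard, Finset.card_compl]
  · intro r _ r' _ h
    simpa using h
  · intro s hs
    rw [Finset.mem_powersetCard] at hs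
    have h1 : (sᶜ).card = 1 := by rw [Finset.card_compl, hs.2]; omega
    obtain ⟨a, ha⟩ := Finset.card_eq_one.1 h1
    exact ⟨a, Finset.mem_univ a, by rw [← ha, compl_compl]⟩
  · intro r _
    have hmem : ∀ x, x ≠ r ↔ x ∈ ({r}ᶜ : Finset V) := by simp
    have hcard : ({r}ᶜ : Finset V).card = Fintype.card V - 1 := by simp [Finset.card_compl]
    rw [Matrix.submatrix_neg, Pi.neg_apply, Pi.neg_apply, Matrix.det_neg, Fintype.card_coe, hcard,
      ← mul_assoc, ← mul_pow]
    simp only [mul_neg, mul_one, neg_neg, one_pow, one_mul]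
    rw [← Matrix.det_submatrix_equiv_self (Equiv.subtypeEquivRight hmem)]
    rfl

/-- All principal minors of corank one equal the tree number, so no root has to be chosen compatibly
along the tower. -/
theorem SerreGraph.coeff_one_charpoly_neg_laplacian (X : SerreGraph) [Fintype X.V]
    [DecidableEq X.V] [Fintype X.E] [Nonempty X.V] (R : Type*) [CommRing R] :
    (-weightedLaplacian X.s X.t (fun _ => (1 : R))).charpoly.coeff 1 =
      Fintype.card X.V * X.numSpanningTrees := by
  have h : weightedLaplacian X.s X.t (fun _ => (1 : R)) =
      (weightedLaplacian X.s X.t (fun _ => (1 : ℤ))).map (Int.castRingHom R) := by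
    rw [weightedLaplacian_map]; simp
  rw [coeff_one_charpoly_neg, h]
  have : ∀ r, (((weightedLaplacian X.s X.t (fun _ => (1 : ℤ))).map (Int.castRingHom R)).submatrix
      (Subtype.val : {v // v ≠ r} → X.V) Subtype.val).det = X.numSpanningTrees := by
    intro r
    rw [Matrix.submatrix_map, ← RingHom.mapMatrix_apply, ← RingHom.map_det,
      X.det_minor_laplacian r]
    simp
  rw [Finset.sum_congr rfl fun r _ => this r, Finset.sum_const, nsmul_eq_mul, Finset.card_univ]

/-! ### Laplacian of a cyclic cover -/

/-- The Fourier matrix `U` block-diagonalises the block circulant. Orthogonality of characters gives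
`U * U' = N`, so `det U` can be cancelled. -/
theorem det_blockCirculant {V R : Type*} [Fintype V] [DecidableEq V] [CommRing R] [IsDomain R]
    {N : ℕ} [NeZero N] (hN : (N : R) ≠ 0) {ψ : AddChar (ZMod N) R} (hψ : ψ.IsPrimitive)
    (B : ZMod N → Matrix V V R) :
    (Matrix.of fun x y : V × ZMod N => B (y.2 - x.2) x.1 y.1).det =
      ∏ c : ZMod N, (∑ k, ψ (c * k) • B k).det := by
  let U : Matrix (V × ZMod N) (V × ZMod N) R :=
    Matrix.of fun x y => if x.1 = y.1 then ψ (x.2 * y.2) else 0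
  let U' : Matrix (V × ZMod N) (V × ZMod N) R :=
    Matrix.of fun x y => if x.1 = y.1 then ψ (-(x.2 * y.2)) else 0
  have hUU : U * U' = (N : R) • 1 := by
    ext ⟨u, i⟩ ⟨v, j⟩
    rw [Matrix.mul_apply, Fintype.sum_prod_type]
    simp only [U, U', Matrix.of_apply]
    rw [Finset.sum_eq_single u (fun b _ hb => by simp [hb.symm]) (by simp)]
    by_cases huv : u = v
    · subst huv
      have : ∀ x : ZMod N, ψ (i * x) * ψ (-(x * j)) = ψ (x * (i - j)) := by
        intro x
        rw [← AddChar.map_add_eq_mul]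
        congr 1
        ring
      simp only [if_true, this, AddChar.sum_mulShift _ hψ, ZMod.card]
      by_cases hij : i = j <;> simp [hij, sub_eq_zero]
    · simp [huv]
  have hU : U.det ≠ 0 := by
    intro h0
    have h := congrArg Matrix.det hUU
    rw [Matrix.det_mul, h0, zero_mul, Matrix.det_smul, Matrix.det_one, mul_one] at h
    exact pow_ne_zero _ hN h.symm
  let D : ZMod N → Matrix V V R := fun c => ∑ k, ψ (c * k) • B k
  have hMU : (Matrix.of fun x y : V × ZMod N => B (y.2 - x.2) x.1 y.1) * U =
      U * Matrix.blockDiagonal D := by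
    ext ⟨v, i⟩ ⟨v', c⟩
    rw [Matrix.mul_apply, Matrix.mul_apply, Fintype.sum_prod_type, Fintype.sum_prod_type]
    simp only [U, D, Matrix.of_apply, Matrix.blockDiagonal_apply]
    rw [Finset.sum_eq_single v' (fun b _ hb => by simp [hb]) (by simp),
      Finset.sum_eq_single v (fun b _ hb => by simp [hb.symm]) (by simp)]
    conv_rhs => rw [Finset.sum_eq_single c (fun b _ hb => by simp [hb]) (by simp)]
    simp only [if_true, Matrix.sum_apply, Matrix.smul_apply, smul_eq_mul, Finset.mul_sum]
    rw [← Equiv.sum_comp (Equiv.addRight i)]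
    refine Finset.sum_congr rfl fun k _ => ?_
    rw [Equiv.coe_addRight, add_sub_cancel_right, ← mul_assoc, ← AddChar.map_add_eq_mul, mul_comm]
    congr 2
    ring
  have h := congrArg Matrix.det hMU
  rw [Matrix.det_mul, Matrix.det_mul, Matrix.det_blockDiagonal, mul_comm] at h
  exact mul_left_cancel₀ hU h

-- In the coordinates `φ` an edge over `e` moves from sheet `i` to sheet `i + a e`, so the block
-- between two sheets depends only on their difference. The circulant formula is applied to the
-- characteristic matrix over `K[X]`.
open Polynomial in
theorem charpoly_neg_weightedLaplacian_cover {V E V' E' K : Type*} [Fintype V] [DecidableEq V]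
    [Fintype E] [Fintype V'] [DecidableEq V'] [Fintype E'] [Field K] [CharZero K]
    (s t : E → V) (s' t' : E' → V') {N : ℕ} [NeZero N] (φ : V × ZMod N ≃ V') (f : E' → E)
    (a : E → ZMod N)
    (hbij : ∀ v i, Set.BijOn f {e' | s' e' = φ (v, i)} {e | s e = v})
    (ht : ∀ e' v i, s' e' = φ (v, i) → t' e' = φ (t (f e'), i + a (f e')))
    {ψ : AddChar (ZMod N) K} (hψ : ψ.IsPrimitive) :
    (-weightedLaplacian s' t' (fun _ => (1 : K))).charpoly =
      ∏ c : ZMod N, (-weightedLaplacian s t (fun e => ψ (c * a e))).charpoly := by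
  let B : ZMod N → Matrix V V K := fun k => Matrix.of fun v v' => ∑ e, if s e = v then
    ((if k = 0 ∧ v = v' then 1 else 0) - if t e = v' ∧ a e = k then 1 else 0) else 0
  have hentry : ∀ v i v' j, weightedLaplacian s' t' (fun _ => (1 : K)) (φ (v, i)) (φ (v', j)) =
      B (j - i) v v' := by
    intro v i v' j
    simp only [B, weightedLaplacian, Matrix.of_apply]
    rw [← Finset.sum_filter, ← Finset.sum_filter]
    refine Finset.sum_bij (fun e' _ => f e') ?_ ?_ ?_ ?_
    · intro e' he'
      simpa using (hbij v i).mapsTo (by simpa using he')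
    · intro e₁ h₁ e₂ h₂ h
      exact (hbij v i).injOn (by simpa using h₁) (by simpa using h₂) h
    · intro e he
      obtain ⟨e', h', rfl⟩ := (hbij v i).surjOn (show e ∈ {e | s e = v} by simpa using he)
      exact ⟨e', by simpa using h', rfl⟩
    · intro e' he'
      rw [ht e' v i (by simpa using he')]
      have h1 : φ (v, i) = φ (v', j) ↔ j - i = 0 ∧ v = v' := by
        rw [φ.apply_eq_iff_eq, Prod.mk.injEq, sub_eq_zero, and_comm, eq_comm (a := i)]
      have h2 : φ (t (f e'), i + a (f e')) = φ (v', j) ↔ t (f e') = v' ∧ a (f e') = j - i := by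
        rw [φ.apply_eq_iff_eq, Prod.mk.injEq, eq_sub_iff_add_eq, add_comm i]
      simp only [h1, h2]
  rw [← Matrix.charpoly_reindex φ.symm]
  let B' : ZMod N → Matrix V V K[X] := fun k => (if k = 0 then (X : K[X]) • 1 else 0) + (B k).map C
  have hchar : Matrix.charmatrix (Matrix.reindex φ.symm φ.symm
      (-weightedLaplacian s' t' (fun _ => (1 : K)))) =
      Matrix.of fun x y : V × ZMod N => B' (y.2 - x.2) x.1 y.1 := by
    ext1 ⟨v, i⟩ ⟨v', j⟩
    have hij : (j = i) = (i = j) := propext eq_comm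
    simp only [B', Matrix.charmatrix_apply, Matrix.reindex_apply, Matrix.submatrix_apply,
      Equiv.symm_symm, Matrix.neg_apply, hentry, Matrix.of_apply, Matrix.add_apply,
      Matrix.map_apply, map_neg, sub_neg_eq_add, sub_eq_zero, Matrix.diagonal_apply, Prod.mk.injEq,
      hij]
    congr 1
    by_cases h1 : i = j <;> by_cases h2 : v = v' <;> simp [h1, h2]
  have hψ' : ((C : K →+* K[X]).toMonoidHom.compAddChar ψ).IsPrimitive :=
    hψ.compMulHom_of_isPrimitive C_injective
  rw [Matrix.charpoly, hchar, det_blockCirculant (by exact_mod_cast NeZero.ne N) hψ']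
  refine Finset.prod_congr rfl fun c _ => ?_
  rw [Matrix.charpoly]
  congr 1
  ext1 v v'
  have hB : ∑ k, ψ (c * k) * B k v v' = weightedLaplacian s t (fun e => ψ (c * a e)) v v' := by
    simp only [B, weightedLaplacian, Matrix.of_apply, Finset.mul_sum]
    rw [Finset.sum_comm]
    refine Finset.sum_congr rfl fun e _ => ?_
    by_cases h1 : s e = v <;> by_cases h2 : v = v' <;> by_cases h3 : t e = v' <;>
      simp [h1, h2, h3, mul_sub]
  simp only [B', Matrix.sum_apply, Matrix.smul_apply, Matrix.add_apply, Matrix.map_apply,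
    smul_eq_mul, mul_add, Finset.sum_add_distrib, Matrix.charmatrix_apply, Matrix.neg_apply,
    map_neg, sub_neg_eq_add, ← hB, map_sum, map_mul]
  congr 1
  rw [Finset.sum_eq_single 0 (fun b _ hb => by simp [hb]) (by simp)]
  simp [Matrix.one_apply, Matrix.diagonal_apply]

/-! ### Coverings, deck transformations and voltages -/

namespace SerreGraph

variable {X Y Z : SerreGraph}

theorem Hom.IsCovering.eq_of_onE_eq {f : Hom Y X} (hf : f.IsCovering) {e e' : Y.E}
    (h : f.onE e = f.onE e') (hs : Y.s e = Y.s e') : e = e' :=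
  (hf.2 (Y.s e)).injOn rfl hs.symm h

theorem Hom.IsCovering.exists_lift {f : Hom Y X} (hf : f.IsCovering) {y : Y.V} {e : X.E}
    (h : X.s e = f.onV y) : ∃ e', Y.s e' = y ∧ f.onE e' = e :=
  (hf.2 y).surjOn h

/-- Two lifts of the same morphism agree if they agree at one vertex. -/
theorem Hom.IsCovering.lift_unique {f : Hom Y X} (hf : f.IsCovering) (hZ : Z.Connected)
    (g h : Hom Z Y) (hE : ∀ e, f.onE (g.onE e) = f.onE (h.onE e)) {z₀ : Z.V}
    (hz : g.onV z₀ = h.onV z₀) : (∀ z, g.onV z = h.onV z) ∧ ∀ e, g.onE e = h.onE e := by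
  have key : ∀ e, g.onV (Z.s e) = h.onV (Z.s e) → g.onE e = h.onE e := fun e he =>
    hf.eq_of_onE_eq (hE e) (by rw [← g.map_s, ← h.map_s, he])
  have hV : ∀ z, g.onV z = h.onV z := by
    intro z
    have := hZ.2 z₀ z
    induction this with
    | refl => exact hz
    | tail _ hbc ih =>
      obtain ⟨e, rfl, rfl⟩ := hbc
      rw [g.map_t, h.map_t, key e ih]
  exact ⟨hV, fun e => key e (hV _)⟩

/-- A deck transformation as a morphism. -/
def Hom.ofDeck (f : Hom Y X) (g : Equiv.Perm Y.V × Equiv.Perm Y.E) (hg : g ∈ f.deckGroup) :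
    Hom Y Y where
  onV := g.1
  onE := g.2
  map_inv := hg.1
  map_s := hg.2.1
  map_t := hg.2.2.1

theorem Hom.onV_deck (f : Hom Y X) {g : Equiv.Perm Y.V × Equiv.Perm Y.E} (hg : g ∈ f.deckGroup)
    (y : Y.V) : f.onV (g.1 y) = f.onV y := hg.2.2.2.1 y

theorem Hom.onE_deck (f : Hom Y X) {g : Equiv.Perm Y.V × Equiv.Perm Y.E} (hg : g ∈ f.deckGroup)
    (e : Y.E) : f.onE (g.2 e) = f.onE e := hg.2.2.2.2 e

theorem Hom.IsCovering.deck_eq {f : Hom Y X} (hf : f.IsCovering) (hY : Y.Connected)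
    {g h : Equiv.Perm Y.V × Equiv.Perm Y.E} (hg : g ∈ f.deckGroup) (hh : h ∈ f.deckGroup)
    {y : Y.V} (hy : g.1 y = h.1 y) : g = h := by
  obtain ⟨hV, hE⟩ := hf.lift_unique hY (f.ofDeck g hg) (f.ofDeck h hh)
    (fun e => (f.onE_deck hg e).trans (f.onE_deck hh e).symm) (z₀ := y) hy
  exact Prod.ext (Equiv.ext hV) (Equiv.ext hE)

/-- The deck transformation `σ` generates the deck group, `w` is a section of `f` on vertices, and
`a` is the resulting voltage assignment: the lift of an edge `e` that starts at `w (s e)` ends at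
`σ ^ a e • w (t e)`. -/
structure Hom.IsVoltage (f : Hom Y X) (a : X.E → ℤ) (σ : Equiv.Perm Y.V × Equiv.Perm Y.E)
    (w : X.V → Y.V) : Prop where
  mem : σ ∈ f.deckGroup
  section_eq : ∀ v, f.onV (w v) = v
  exists_zpow : ∀ y, ∃ i : ℤ, (σ ^ i).1 (w (f.onV y)) = y
  target : ∀ e', Y.s e' = w (X.s (f.onE e')) →
    Y.t e' = (σ ^ a (f.onE e')).1 (w (X.t (f.onE e')))

theorem zpow_fst_add (σ : Equiv.Perm Y.V × Equiv.Perm Y.E) (i j : ℤ) (y : Y.V) :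
    (σ ^ (i + j)).1 y = (σ ^ i).1 ((σ ^ j).1 y) := by
  rw [zpow_add]; rfl

/-- The cyclic deck group is transitive on fibres, so the end of each lifted edge is a power of the
generator applied to the section. -/
theorem Hom.IsGalois.exists_isVoltage {f : Hom Y X} (hf : f.IsGalois) {N : ℕ}
    (hG : Nonempty (f.deckGroup ≃* Multiplicative (ZMod N))) :
    ∃ a : X.E → ℤ, (∀ e, a (X.inv e) = -a e) ∧ ∃ σ w, f.IsVoltage a σ w := by
  obtain ⟨iso⟩ := hG
  obtain ⟨hY, -, hcov, htrans⟩ := hf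
  have hcyc : IsCyclic f.deckGroup := isCyclic_of_surjective iso.symm iso.symm.surjective
  obtain ⟨σ, hσ⟩ := hcyc.exists_generator
  have hgen : ∀ g ∈ f.deckGroup, ∃ i : ℤ, σ.1 ^ i = g := by
    intro g hg
    obtain ⟨i, hi⟩ := Subgroup.mem_zpowers_iff.1 (hσ ⟨g, hg⟩)
    exact ⟨i, by rw [← SubgroupClass.coe_zpow, hi]⟩
  choose w hw using hcov.1
  have hex : ∀ y, ∃ i : ℤ, (σ.1 ^ i).1 (w (f.onV y)) = y := by
    intro y
    obtain ⟨g, hg, h⟩ := htrans (w (f.onV y)) y (hw _)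
    obtain ⟨i, rfl⟩ := hgen g hg
    exact ⟨i, h⟩
  have ha : ∀ e, ∃ i : ℤ, ∀ e', f.onE e' = e → Y.s e' = w (X.s e) →
      Y.t e' = (σ.1 ^ i).1 (w (X.t e)) := by
    intro e
    obtain ⟨e₁, h1, h2⟩ := hcov.exists_lift (y := w (X.s e)) (e := e) (hw _).symm
    obtain ⟨i, hi⟩ := hex (Y.t e₁)
    rw [f.map_t, h2] at hi
    refine ⟨i, fun e' h3 h4 => ?_⟩
    rw [hcov.eq_of_onE_eq (h3.trans h2.symm) (h4.trans h1.symm), hi]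
  choose a₀ ha₀ using ha
  have hneg : ∀ e e', f.onE e' = e → Y.s e' = w (X.s e) →
      Y.t e' = (σ.1 ^ (-a₀ (X.inv e))).1 (w (X.t e)) := by
    intro e e' h1 h2
    obtain ⟨e₁, h3, h4⟩ := hcov.exists_lift (y := w (X.t e)) (e := X.inv e)
      (by rw [hw, X.s_inv])
    have h5 := ha₀ _ e₁ h4 (by rw [h3, X.s_inv])
    rw [X.t_inv] at h5
    have hd : σ.1 ^ (-a₀ (X.inv e)) ∈ f.deckGroup := Subgroup.zpow_mem _ σ.2 _
    have h6 : e' = (σ.1 ^ (-a₀ (X.inv e))).2 (Y.inv e₁) := by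
      refine hcov.eq_of_onE_eq ?_ ?_
      · rw [f.onE_deck hd, f.map_inv, h4, X.inv_inv, h1]
      · rw [← hd.2.1, Y.s_inv, h5, ← zpow_fst_add, neg_add_cancel, h2]; rfl
    rw [h6, ← hd.2.2.1, Y.t_inv, h3]
  -- Voltages are determined only modulo `N`. Numbering the edges picks one from each opposite pair,
  -- which makes antisymmetry exact in `ℤ`.
  obtain ⟨n, ⟨ι⟩⟩ := Finite.exists_equiv_fin X.E
  refine ⟨fun e => if ι e < ι (X.inv e) then a₀ e else -a₀ (X.inv e), fun e => ?_, σ.1, w, σ.2, hw,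
    hex, fun e' h => ?_⟩
  · have hne : ι (X.inv e) ≠ ι e := fun h => X.inv_ne e (ι.injective h)
    simp only [X.inv_inv]
    rcases lt_or_gt_of_ne hne with h | h
    · rw [if_pos h, if_neg h.not_gt, neg_neg]
    · rw [if_pos h, if_neg h.not_gt]
  · split_ifs
    · exact ha₀ _ e' rfl h
    · exact hneg _ e' rfl h

/-- Choose `τ` agreeing with the image of `σ` at one vertex; unique lifting makes `g` intertwine `σ`
and `τ`. The same integers `a` thus serve the lower level. -/
theorem Hom.IsVoltage.descend {f : Hom Y X} {g : Hom Z Y} {a : X.E → ℤ}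
    {σ : Equiv.Perm Z.V × Equiv.Perm Z.E} {w : X.V → Z.V} (h : (f.comp g).IsVoltage a σ w)
    (hf : f.IsGalois) (hg : g.IsCovering) (hZ : Z.Connected) :
    ∃ τ w', f.IsVoltage a τ w' := by
  obtain ⟨hY, hX, hcov, htrans⟩ := hf
  obtain ⟨z₀⟩ := hZ.1
  obtain ⟨τ, hτ, hz⟩ := htrans (g.onV z₀) (g.onV (σ.1 z₀)) (h.mem.2.2.2.1 z₀).symm
  obtain ⟨hV, -⟩ := hcov.lift_unique hZ ((f.ofDeck τ hτ).comp g)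
    (g.comp ((f.comp g).ofDeck σ h.mem))
    (fun e => (f.onE_deck hτ _).trans ((f.comp g).onE_deck h.mem e).symm) (z₀ := z₀) hz
  have hone : ∀ z, τ.1 (g.onV z) = g.onV (σ.1 z) := hV
  have hnat : ∀ (n : ℕ) z, (τ ^ n).1 (g.onV z) = g.onV ((σ ^ n).1 z) := by
    intro n
    induction n with
    | zero => intro z; rfl
    | succ n ih =>
      intro z
      rw [pow_succ, pow_succ]
      exact (congrArg _ (hone z)).trans (ih _)
  have hpow : ∀ (i : ℤ) z, (τ ^ i).1 (g.onV z) = g.onV ((σ ^ i).1 z) := by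
    intro i z
    obtain ⟨n, rfl | rfl⟩ := i.eq_nat_or_neg
    · simpa using hnat n z
    · have h1 := hnat n ((σ ^ (-n : ℤ)).1 z)
      rw [← zpow_natCast σ, ← zpow_fst_add, add_neg_cancel, zpow_zero] at h1
      have h2 : (τ ^ (-n : ℤ)).1 ((τ ^ (n : ℤ)).1 (g.onV ((σ ^ (-n : ℤ)).1 z))) =
          g.onV ((σ ^ (-n : ℤ)).1 z) := by
        rw [← zpow_fst_add, neg_add_cancel]; rfl
      rw [← h2, zpow_natCast, h1]
      rfl
  refine ⟨τ, fun v => g.onV (w v), hτ, h.section_eq, fun y => ?_, fun e' he' => ?_⟩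
  · obtain ⟨z, rfl⟩ := hg.1 y
    obtain ⟨i, hi⟩ := h.exists_zpow z
    exact ⟨i, (hpow _ _).trans (congrArg _ hi)⟩
  · obtain ⟨e, h1, rfl⟩ := hg.exists_lift he'
    rw [← g.map_t, h.target e h1, hpow]
    rfl

variable {f : Hom Y X} {a : X.E → ℤ} {σ : Equiv.Perm Y.V × Equiv.Perm Y.E} {w : X.V → Y.V}

theorem Hom.IsVoltage.zpow_mem (h : f.IsVoltage a σ w) (i : ℤ) : σ ^ i ∈ f.deckGroup :=
  Subgroup.zpow_mem _ h.mem i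

theorem Hom.IsVoltage.orderOf_eq (h : f.IsVoltage a σ w) (hf : f.IsGalois) :
    orderOf σ = Nat.card f.deckGroup := by
  obtain ⟨hY, ⟨⟨v⟩, -⟩, hcov, -⟩ := hf
  have : Subgroup.zpowers σ = f.deckGroup := by
    refine le_antisymm (by rw [Subgroup.zpowers_le]; exact h.mem) fun g hg => ?_
    obtain ⟨i, hi⟩ := h.exists_zpow (g.1 (w v))
    rw [f.onV_deck hg, h.section_eq] at hi
    exact Subgroup.mem_zpowers_iff.2 ⟨i, hcov.deck_eq hY (h.zpow_mem i) hg hi⟩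
  rw [← this, Nat.card_zpowers]

theorem Hom.IsVoltage.exists_equiv (h : f.IsVoltage a σ w) (hf : f.IsGalois) {N : ℕ} [NeZero N]
    (hN : Nat.card f.deckGroup = N) :
    ∃ φ : X.V × ZMod N ≃ Y.V, (∀ v i, Set.BijOn f.onE {e' | Y.s e' = φ (v, i)} {e | X.s e = v}) ∧
      ∀ e' v i, Y.s e' = φ (v, i) → Y.t e' = φ (X.t (f.onE e'), i + (a (f.onE e') : ZMod N)) := by
  have hord : orderOf σ = N := (h.orderOf_eq hf).trans hN
  obtain ⟨hY, -, hcov, -⟩ := hf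
  have hpow : ∀ i j : ℤ, σ ^ i = σ ^ j ↔ (i : ZMod N) = j := by
    intro i j
    rw [zpow_eq_zpow_iff_modEq, hord, ZMod.intCast_eq_intCast_iff]
  have hval : ∀ i : ℤ, σ ^ ((i : ZMod N).val : ℤ) = σ ^ i := fun i => (hpow _ _).2 (by simp)
  let φ₀ : X.V × ZMod N → Y.V := fun x => (σ ^ (x.2.val : ℤ)).1 (w x.1)
  have hfφ : ∀ x, f.onV (φ₀ x) = x.1 := fun x =>
    (f.onV_deck (h.zpow_mem _) _).trans (h.section_eq _)
  have hbij : Function.Bijective φ₀ := by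
    constructor
    · rintro ⟨v, i⟩ ⟨v', j⟩ hij
      have hv : v = v' := (hfφ (v, i)).symm.trans ((congrArg f.onV hij).trans (hfφ (v', j)))
      subst hv
      have := (hpow _ _).1 (hcov.deck_eq hY (h.zpow_mem _) (h.zpow_mem _) hij)
      rw [Int.cast_natCast, Int.cast_natCast, ZMod.natCast_zmod_val, ZMod.natCast_zmod_val] at this
      change i = j at this
      rw [this]
    · intro y
      obtain ⟨i, hi⟩ := h.exists_zpow y
      exact ⟨(f.onV y, i), by simp only [φ₀, hval]; exact hi⟩
  refine ⟨Equiv.ofBijective φ₀ hbij, fun v i => ?_, fun e' v i he' => ?_⟩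
  · have := hcov.2 (φ₀ (v, i))
    rw [hfφ] at this
    exact this
  · change Y.s e' = φ₀ (v, i) at he'
    change Y.t e' = φ₀ _
    have hv : X.s (f.onE e') = v := by rw [← f.map_s, he', hfφ]
    -- Translate `e'` back to sheet zero, where the voltage is defined.
    have hd := h.zpow_mem (-(i.val : ℤ))
    have h1 : Y.s ((σ ^ (-(i.val : ℤ))).2 e') =
        w (X.s (f.onE ((σ ^ (-(i.val : ℤ))).2 e'))) := by
      rw [← hd.2.1, he', f.onE_deck hd, hv, ← zpow_fst_add, neg_add_cancel]
      rfl
    have h2 := h.target _ h1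
    rw [← hd.2.2.1, f.onE_deck hd] at h2
    have h3 : Y.t e' = (σ ^ (i.val : ℤ)).1 ((σ ^ (-(i.val : ℤ))).1 (Y.t e')) := by
      rw [← zpow_fst_add, add_neg_cancel]; rfl
    rw [h3, h2, ← zpow_fst_add]
    change _ = (σ ^ ((i + (a (f.onE e') : ZMod N)).val : ℤ)).1 _
    rw [show i + (a (f.onE e') : ZMod N) = (((i.val : ℤ) + a (f.onE e') : ℤ) : ZMod N) by simp, hval]

end SerreGraph

namespace UnramifiedZpCovering

open SerreGraph

variable {p : ℕ} (T : UnramifiedZpCovering p)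

theorem exists_voltage (m : ℕ) : ∃ a : (T.X 0).E → ℤ, (∀ e, a ((T.X 0).inv e) = -a e) ∧
    ∀ k ≤ m, ∃ σ w, (towerToBase T.X T.π k).IsVoltage a σ w := by
  obtain ⟨a, ha, h⟩ := (T.isGalois m).exists_isVoltage (T.galoisGroup m)
  refine ⟨a, ha, fun k hk => ?_⟩
  induction hk using Nat.decreasingInduction with
  | of_succ k hk ih =>
    obtain ⟨σ, w, h⟩ := ih
    exact Hom.IsVoltage.descend (f := towerToBase T.X T.π k) h (T.isGalois k) (T.isCovering k)
      (T.connected (k + 1))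
  | self => exact h

theorem card_deckGroup (n : ℕ) : Nat.card (towerToBase T.X T.π n).deckGroup = p ^ n := by
  obtain ⟨iso⟩ := T.galoisGroup n
  rw [Nat.card_congr iso.toEquiv, Nat.card_congr Multiplicative.toAdd, Nat.card_zmod]

end UnramifiedZpCovering

/-! ### Symmetry of the twisted determinant -/

section Symmetric

open LaurentPolynomial Polynomial

/-- Integral Laurent polynomials invariant under `T ↦ T⁻¹` are polynomials in `T + T⁻¹ - 2`. -/
theorem LaurentPolynomial.exists_aeval_eq_of_invert_eq (F : ℤ[T;T⁻¹]) (hF : invert F = F) :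
    ∃ h : ℤ[X], aeval (T 1 + T (-1) - 2 : ℤ[T;T⁻¹]) h = F := by
  set A : Subalgebra ℤ ℤ[T;T⁻¹] := (aeval (T 1 + T (-1) - 2 : ℤ[T;T⁻¹])).range with hA
  have hs : (T 1 + T (-1) : ℤ[T;T⁻¹]) ∈ A :=
    ⟨(Polynomial.X + 2 : ℤ[X]), by
      change aeval _ (Polynomial.X + 2 : ℤ[X]) = _
      rw [map_add, aeval_X, map_ofNat, sub_add_cancel]⟩
  have hT : ∀ n : ℕ, (T n + T (-n) : ℤ[T;T⁻¹]) ∈ A := by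
    intro n
    induction n using Nat.twoStepInduction with
    | zero => simpa using A.add_mem A.one_mem A.one_mem
    | one => exact hs
    | more n h0 h1 =>
      have : (T ((n + 2 : ℕ) : ℤ) + T (-((n + 2 : ℕ) : ℤ)) : ℤ[T;T⁻¹]) =
          (T 1 + T (-1)) * (T ((n + 1 : ℕ) : ℤ) + T (-((n + 1 : ℕ) : ℤ))) -
            (T (n : ℤ) + T (-(n : ℤ))) := by
        simp only [mul_add, add_mul, ← T_add]
        rw [show (1 : ℤ) + ((n + 1 : ℕ) : ℤ) = ((n + 2 : ℕ) : ℤ) by push_cast; ring,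
          show (1 : ℤ) + -((n + 1 : ℕ) : ℤ) = -(n : ℤ) by push_cast; ring,
          show (-1 : ℤ) + ((n + 1 : ℕ) : ℤ) = (n : ℤ) by push_cast; ring,
          show (-1 : ℤ) + -((n + 1 : ℕ) : ℤ) = -((n + 2 : ℕ) : ℤ) by push_cast; ring]
        ring
      rw [this]
      exact A.sub_mem (A.mul_mem hs h1) h0
  have hT' : ∀ k : ℤ, (T k + T (-k) : ℤ[T;T⁻¹]) ∈ A := by
    intro k
    obtain ⟨n, rfl | rfl⟩ := k.eq_nat_or_neg
    · exact hT n
    · rw [neg_neg, add_comm]; exact hT n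
  have hC : ∀ c : ℤ, (LaurentPolynomial.C c : ℤ[T;T⁻¹]) ∈ A := fun c => A.algebraMap_mem c
  -- Induction on the size of the support: subtracting a multiple of `T k + T (-k)` removes `k`
  -- without enlarging it.
  suffices ∀ n, ∀ F : ℤ[T;T⁻¹], F.coeff.support.card = n → invert F = F → F ∈ A from
    this _ F rfl hF
  intro n
  induction n using Nat.strong_induction_on with
  | _ n ih =>
    intro F hn hF
    have hsymm : ∀ k, F.coeff (-k) = F.coeff k := fun k => by
      rw [← LaurentPolynomial.invert_apply, hF]
    by_cases hk : ∃ k, k ≠ 0 ∧ F.coeff k ≠ 0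
    · obtain ⟨k, hk0, hk⟩ := hk
      set F' : ℤ[T;T⁻¹] := F - F.coeff k • (T k + T (-k)) with hF'
      have hcoeff : ∀ j, F'.coeff j =
          F.coeff j - F.coeff k * ((if k = j then 1 else 0) + if -k = j then 1 else 0) := by
        intro j
        simp only [hF', AddMonoidAlgebra.coeff_sub, AddMonoidAlgebra.coeff_smul,
          AddMonoidAlgebra.coeff_add, Finsupp.sub_apply, Finsupp.smul_apply, Finsupp.add_apply,
          T_apply, smul_eq_mul]
      have hinv : invert F' = F' := by
        ext j
        rw [LaurentPolynomial.invert_apply, hcoeff, hcoeff, hsymm]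
        congr 2
        rw [add_comm]
        exact congrArg₂ _ (if_congr (by omega) rfl rfl) (if_congr (by omega) rfl rfl)
      have hss : F'.coeff.support ⊂ F.coeff.support := by
        rw [Finset.ssubset_iff_of_subset]
        · refine ⟨k, by simpa using hk, ?_⟩
          have : -k ≠ k := by omega
          simp [hcoeff, this]
        · intro j
          simp only [Finsupp.mem_support_iff]
          intro hj hj0
          apply hj
          have h1 : k ≠ j := by rintro rfl; exact hk hj0
          have h2 : -k ≠ j := by rintro rfl; exact hk ((hsymm k).symm.trans hj0)
          simp [hcoeff, hj0, h1, h2]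
      have := ih _ (hn ▸ Finset.card_lt_card hss) F' rfl hinv
      rw [← sub_add_cancel F (F.coeff k • (T k + T (-k)))]
      exact A.add_mem this (A.smul_mem (hT' k) _)
    · push Not at hk
      have : F = LaurentPolynomial.C (F.coeff 0) := by
        ext j
        rw [LaurentPolynomial.C_apply]
        split_ifs with h
        · rw [h]
        · exact hk j h
      rw [this]
      exact hC _

end Symmetric

theorem weightedLaplacian_transpose {V E R : Type*} [Fintype E] [DecidableEq V] [CommRing R]
    (s t : E → V) (w : E → R) (inv : E ≃ E) (hs : ∀ e, s (inv e) = t e)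
    (ht : ∀ e, t (inv e) = s e) :
    (weightedLaplacian s t w).transpose = weightedLaplacian s t fun e => w (inv e) := by
  ext v v'
  have hsplit : ∀ (w : E → R) (v v' : V), weightedLaplacian s t w v v' =
      (if v = v' then ∑ e, if s e = v then 1 else 0 else 0) -
        ∑ e, if s e = v ∧ t e = v' then w e else 0 := by
    intro w v v'
    by_cases h : v = v'
    · simp only [if_pos h, weightedLaplacian, Matrix.of_apply, ← Finset.sum_sub_distrib]
      refine Finset.sum_congr rfl fun e _ => ?_
      by_cases h1 : s e = v <;> by_cases h2 : t e = v' <;> simp [h1, h2]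
    · simp only [if_neg h, weightedLaplacian, Matrix.of_apply, zero_sub, ← Finset.sum_neg_distrib]
      refine Finset.sum_congr rfl fun e _ => ?_
      by_cases h1 : s e = v <;> by_cases h2 : t e = v' <;> simp [h1, h2]
  rw [Matrix.transpose_apply, hsplit, hsplit]
  congr 1
  · by_cases h : v = v'
    · rw [h]
    · rw [if_neg h, if_neg (Ne.symm h)]
  · rw [← inv.sum_comp]
    simp only [hs, ht, and_comm]

-- Inverting `T` transposes the Laplacian with weights `T (a e)`, because `a` is odd under edge
-- reversal; its determinant is therefore symmetric.
open LaurentPolynomial Polynomial in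
theorem SerreGraph.exists_det_voltage_eq (X : SerreGraph) [Fintype X.V] [DecidableEq X.V]
    [Fintype X.E] (a : X.E → ℤ) (ha : ∀ e, a (X.inv e) = -a e) (K : Type*) [Field K] :
    ∃ h : ℤ[X], ∀ ζ : K, ζ ≠ 0 →
      (weightedLaplacian X.s X.t fun e => ζ ^ a e).det = aeval (ζ + ζ⁻¹ - 2) h := by
  let L : Matrix X.V X.V ℤ[T;T⁻¹] := weightedLaplacian X.s X.t fun e => T (a e)
  let i : X.E ≃ X.E := ⟨X.inv, X.inv, X.inv_inv, X.inv_inv⟩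
  have hL : invert L.det = L.det := by
    have h1 : L.map ((invert : ℤ[T;T⁻¹] ≃ₐ[ℤ] ℤ[T;T⁻¹]) : ℤ[T;T⁻¹] →+* ℤ[T;T⁻¹]) =
        L.transpose := by
      simp only [L]
      rw [weightedLaplacian_map, weightedLaplacian_transpose _ _ _ i X.s_inv X.t_inv]
      congr 1
      funext e
      change invert (T (a e)) = T (a (X.inv e))
      rw [invert_T, ha]
    have h2 := RingHom.map_det ((invert : ℤ[T;T⁻¹] ≃ₐ[ℤ] ℤ[T;T⁻¹]) : ℤ[T;T⁻¹] →+* ℤ[T;T⁻¹]) L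
    rw [RingHom.mapMatrix_apply, h1, Matrix.det_transpose] at h2
    exact h2
  obtain ⟨h, hh⟩ := exists_aeval_eq_of_invert_eq _ hL
  refine ⟨h, fun ζ hζ => ?_⟩
  let ev : ℤ[T;T⁻¹] →+* K := LaurentPolynomial.eval₂ (Int.castRingHom K) (Units.mk0 ζ hζ)
  have hev : ∀ n, ev (T n) = ζ ^ n := fun n => by simp [ev]
  have h3 : ev L.det = (weightedLaplacian X.s X.t fun e => ζ ^ a e).det := by
    rw [RingHom.map_det, RingHom.mapMatrix_apply, weightedLaplacian_map]
    simp only [hev]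
  rw [← h3, ← hh, aeval_def, hom_eval₂, aeval_def]
  congr 1
  · exact RingHom.ext_int _ _
  · rw [map_sub, map_add, hev, hev, map_ofNat]
    simp

theorem coeff_zero_charpoly_neg {V R : Type*} [Fintype V] [DecidableEq V] [CommRing R]
    (M : Matrix V V R) : (-M).charpoly.coeff 0 = M.det := by
  have h := Matrix.det_eq_sign_charpoly_coeff (-M)
  rw [Matrix.det_neg] at h
  have h2 := congrArg (fun x => (-1 : R) ^ Fintype.card V * x) h
  simpa [← mul_assoc, ← mul_pow] using h2.symm

/-! ### Tree numbers at consecutive levels -/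

namespace UnramifiedZpCovering

open SerreGraph Polynomial

variable {p : ℕ} [Fact p.Prime] (T : UnramifiedZpCovering p)

theorem charpoly_eq_prod [∀ n, Fintype (T.X n).V] [∀ n, DecidableEq (T.X n).V]
    [∀ n, Fintype (T.X n).E] {K : Type*} [Field K] [CharZero K] {n : ℕ} {a : (T.X 0).E → ℤ} {σ w}
    (h : (towerToBase T.X T.π n).IsVoltage a σ w) {ζ : K} (hζ : IsPrimitiveRoot ζ (p ^ n)) :
    (-weightedLaplacian (T.X n).s (T.X n).t fun _ => (1 : K)).charpoly =
      ∏ ξ ∈ nthRootsFinset (p ^ n) (1 : K),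
        (-weightedLaplacian (T.X 0).s (T.X 0).t fun e => ξ ^ a e).charpoly := by
  have : NeZero (p ^ n) := ⟨pow_ne_zero _ (Fact.out : p.Prime).ne_zero⟩
  obtain ⟨φ, hφ, hφ'⟩ := h.exists_equiv (T.isGalois n) (T.card_deckGroup n)
  have hψ := AddChar.zmodChar_primitive_of_primitive_root (p ^ n) hζ
  set ψ := AddChar.zmodChar (p ^ n) ((IsPrimitiveRoot.iff_def ζ _).1 hζ).left with hψdef
  rw [charpoly_neg_weightedLaplacian_cover _ _ _ _ φ _ (fun e => (a e : ZMod (p ^ n))) hφ hφ' hψ]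
  refine Finset.prod_bij (fun c _ => ψ c) ?_ ?_ ?_ ?_
  · intro c _
    rw [mem_nthRootsFinset (Nat.pos_of_neZero _), ← AddChar.map_nsmul_eq_pow]
    simp
  · intro c _ c' _ hc
    have : ψ (c - c') = 1 := by
      rw [AddChar.map_sub_eq_div, hc, div_self]
      rw [hψdef, AddChar.zmodChar_apply]
      exact pow_ne_zero _ (hζ.ne_zero (NeZero.ne _))
    exact sub_eq_zero.1 ((AddChar.IsPrimitive.zmod_char_eq_one_iff _ hψ _).1 this)
  · intro ξ hξ
    rw [mem_nthRootsFinset (Nat.pos_of_neZero _)] at hξ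
    obtain ⟨i, -, hi⟩ := hζ.eq_pow_of_pow_eq_one hξ
    exact ⟨(i : ZMod (p ^ n)), Finset.mem_univ _, by rw [hψdef, AddChar.zmodChar_apply', hi]⟩
  · intro c _
    have : ∀ e, ψ (c * (a e : ZMod (p ^ n))) = ψ c ^ a e := by
      intro e
      rw [← AddChar.map_zsmul_eq_zpow, zsmul_eq_mul, mul_comm]
    simp only [this]

/-- The roots of unity new at level `k + 1` are the primitive ones. The factor `p` is the ratio of
the vertex numbers, and `h` vanishes at zero because `ζ = 1` gives the singular untwisted Laplacian.
-/
theorem numSpanningTrees_succ (K : Type*) [Field K] [CharZero K] [IsAlgClosed K] (m : ℕ) :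
    ∃ h : ℤ[X], h.coeff 0 = 0 ∧ ∀ k < m,
      (p * (T.X (k + 1)).numSpanningTrees : K) = (T.X k).numSpanningTrees *
        ∏ ζ ∈ primitiveRoots (p ^ (k + 1)) K, aeval (ζ + ζ⁻¹ - 2) h := by
  classical
  have := fun n => Fintype.ofFinite (T.X n).V
  have := fun n => Fintype.ofFinite (T.X n).E
  have hp : p.Prime := Fact.out
  have hne : ∀ n, Nonempty (T.X n).V := fun n => (T.connected n).1
  obtain ⟨a, ha, hvolt⟩ := T.exists_voltage m
  obtain ⟨h, hh⟩ := (T.X 0).exists_det_voltage_eq a ha K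
  refine ⟨h, ?_, fun k hk => ?_⟩
  · have h1 := hh 1 one_ne_zero
    simp only [one_zpow, weightedLaplacian_one_det] at h1
    have h2 : (1 : K) + 1⁻¹ - 2 = 0 := by norm_num
    rw [h2, ← coeff_zero_eq_aeval_zero'] at h1
    simpa using h1.symm
  · have hcard : ∀ n ≤ m, Fintype.card (T.X n).V = Fintype.card (T.X 0).V * p ^ n := by
      intro n hn
      have : NeZero (p ^ n) := ⟨pow_ne_zero _ hp.ne_zero⟩
      obtain ⟨σ, w, hv⟩ := hvolt n hn
      obtain ⟨φ, -, -⟩ := hv.exists_equiv (T.isGalois n) (T.card_deckGroup n)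
      rw [← Fintype.card_congr φ, Fintype.card_prod, ZMod.card]
    have hroot : ∀ n, ∃ ζ : K, IsPrimitiveRoot ζ (p ^ n) := fun n =>
      have : NeZero ((p ^ n : ℕ) : K) := ⟨by exact_mod_cast pow_ne_zero _ hp.ne_zero⟩
      HasEnoughRootsOfUnity.exists_primitiveRoot K (p ^ n)
    obtain ⟨ζ, hζ⟩ := hroot k
    obtain ⟨ζ', hζ'⟩ := hroot (k + 1)
    obtain ⟨σ, w, hv⟩ := hvolt k hk.le
    obtain ⟨σ', w', hv'⟩ := hvolt (k + 1) hk
    have h0 := T.charpoly_eq_prod hv hζ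
    have h1 := T.charpoly_eq_prod hv' hζ'
    have hunion : nthRootsFinset (p ^ (k + 1)) (1 : K) =
        nthRootsFinset (p ^ k) (1 : K) ∪ primitiveRoots (p ^ (k + 1)) K := by
      ext ξ
      rw [Finset.mem_union, mem_nthRootsFinset (pow_pos hp.pos _),
        mem_nthRootsFinset (pow_pos hp.pos _), mem_primitiveRoots (pow_pos hp.pos _)]
      constructor
      · intro h
        by_cases h' : ξ ^ p ^ k = 1
        · exact Or.inl h'
        · right
          rw [← orderOf_eq_prime_pow h' h]
          exact IsPrimitiveRoot.orderOf ξ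
      · rintro (h | h)
        · rw [pow_succ, pow_mul, h, one_pow]
        · exact h.pow_eq_one
    have hdisj : Disjoint (nthRootsFinset (p ^ k) (1 : K)) (primitiveRoots (p ^ (k + 1)) K) := by
      rw [Finset.disjoint_left]
      intro ξ h2 h3
      rw [mem_nthRootsFinset (pow_pos hp.pos _)] at h2
      rw [mem_primitiveRoots (pow_pos hp.pos _)] at h3
      exact absurd (Nat.le_of_dvd (pow_pos hp.pos _) (h3.dvd_of_pow_eq_one _ h2))
        (Nat.pow_lt_pow_right hp.one_lt (Nat.lt_succ_self k)).not_ge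
    rw [hunion, Finset.prod_union hdisj, ← h0] at h1
    -- The level-`k` factor has zero constant term, so only the constant terms of the new factors
    -- enter the linear coefficient.
    have h4 := congrArg (fun q : K[X] => q.coeff 1) h1
    simp only [mul_coeff_one, coeff_zero_charpoly_neg, weightedLaplacian_one_det, zero_mul,
      zero_add, coeff_one_charpoly_neg_laplacian, hcard k hk.le, hcard (k + 1) hk] at h4
    rw [coeff_zero_prod] at h4
    have h5 : ∀ ξ ∈ primitiveRoots (p ^ (k + 1)) K,
        ((-weightedLaplacian (T.X 0).s (T.X 0).t fun e => ξ ^ a e).charpoly).coeff 0 =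
          aeval (ξ + ξ⁻¹ - 2) h := by
      intro ξ hξ
      rw [coeff_zero_charpoly_neg, hh]
      exact (isPrimitiveRoot_of_mem_primitiveRoots hξ).ne_zero (pow_ne_zero _ hp.ne_zero)
    rw [Finset.prod_congr rfl h5] at h4
    have h6 : ((Fintype.card (T.X 0).V * p ^ k : ℕ) : K) ≠ 0 :=
      Nat.cast_ne_zero.2 (mul_ne_zero Fintype.card_ne_zero (pow_ne_zero _ hp.ne_zero))
    refine mul_left_cancel₀ h6 ?_
    rw [← mul_assoc, ← mul_assoc, ← h4]
    push_cast
    ring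

end UnramifiedZpCovering

/-! ### Ultrametric estimates at roots of unity -/

section Ultrametric

variable {K : Type*} [NormedField K]

theorem IsPrimitiveRoot.norm_eq_one_of_ne_zero {ζ : K} {n : ℕ} (h : IsPrimitiveRoot ζ n)
    (hn : n ≠ 0) : ‖ζ‖ = 1 := by
  rw [← pow_eq_one_iff_of_nonneg (norm_nonneg _) hn, ← norm_pow, h.pow_eq_one, norm_one]

/-- From $(\zeta - 1)^2 = \zeta(\zeta + \zeta^{-1} - 2)$; this square is the source of the even
contribution to $\lambda$. -/
theorem norm_add_inv_sub_two {ζ : K} (hζ : ‖ζ‖ = 1) : ‖ζ + ζ⁻¹ - 2‖ = ‖ζ - 1‖ ^ 2 := by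
  have h0 : ζ ≠ 0 := norm_ne_zero_iff.1 (by rw [hζ]; exact one_ne_zero)
  have : (ζ - 1) ^ 2 = ζ * (ζ + ζ⁻¹ - 2) := by field_simp; ring
  rw [← norm_pow, this, norm_mul, hζ, one_mul]

variable [IsUltrametricDist K]

theorem norm_pow_sub_one_le {ζ : K} (hζ : ‖ζ‖ = 1) (i : ℕ) : ‖ζ ^ i - 1‖ ≤ ‖ζ - 1‖ := by
  rw [← mul_geom_sum, norm_mul]
  refine mul_le_of_le_one_right (norm_nonneg _) ?_
  refine IsUltrametricDist.norm_sum_le_of_forall_le_of_nonneg zero_le_one fun j _ => ?_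
  rw [norm_pow, hζ, one_pow]

theorem IsPrimitiveRoot.norm_sub_one_eq {ζ ξ : K} {n : ℕ} (hζ : IsPrimitiveRoot ζ n)
    (hξ : IsPrimitiveRoot ξ n) (hn : n ≠ 0) : ‖ζ - 1‖ = ‖ξ - 1‖ := by
  have key : ∀ {ζ ξ : K}, IsPrimitiveRoot ζ n → IsPrimitiveRoot ξ n → ‖ξ - 1‖ ≤ ‖ζ - 1‖ := by
    intro ζ ξ hζ hξ
    have : NeZero n := ⟨hn⟩
    obtain ⟨i, -, rfl⟩ := hζ.eq_pow_of_pow_eq_one hξ.pow_eq_one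
    exact norm_pow_sub_one_le (hζ.norm_eq_one_of_ne_zero hn) i
  exact le_antisymm (key hξ hζ) (key hζ hξ)

/-- The product of all $1 - \xi$ is the cyclotomic polynomial at $1$, that is $p$, and its factors
have equal norm. -/
theorem IsPrimitiveRoot.norm_sub_one_pow_totient {p k : ℕ} [Fact p.Prime] {ζ : K}
    (hζ : IsPrimitiveRoot ζ (p ^ (k + 1))) :
    ‖ζ - 1‖ ^ (p ^ (k + 1)).totient = ‖(p : K)‖ := by
  have hp : p.Prime := Fact.out
  have hn : p ^ (k + 1) ≠ 0 := pow_ne_zero _ hp.ne_zero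
  have h := Polynomial.eval_one_cyclotomic_prime_pow (R := K) (p := p) k
  rw [Polynomial.cyclotomic_eq_prod_X_sub_primitiveRoots hζ, Polynomial.eval_prod] at h
  rw [← h, norm_prod, ← hζ.card_primitiveRoots]
  symm
  refine Finset.prod_eq_pow_card fun ξ hξ => ?_
  rw [Polynomial.eval_sub, Polynomial.eval_X, Polynomial.eval_C, norm_sub_rev]
  exact (isPrimitiveRoot_of_mem_primitiveRoots hξ).norm_sub_one_eq hζ hn

open Polynomial

/-- The value of a polynomial at a small element is dominated by a single term. -/
theorem norm_aeval_eq_of_dominant {s : K} {ρ r : ℝ} (h0 : 0 < ρ) (h1 : ρ < 1) (hs : ‖s‖ = ρ ^ 2)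
    {d : ℕ} (hr : r = ρ ^ d) (b : ℤ[X]) {μ j₀ M : ℕ} (hb : ∀ j < M, ‖(b.coeff j : K)‖ ≤ r ^ μ)
    (hb' : ∀ j < j₀, ‖(b.coeff j : K)‖ ≤ r ^ (μ + 1)) (hb₀ : ‖(b.coeff j₀ : K)‖ = r ^ μ)
    (hd : 2 * j₀ < d) (hM : d * μ + 2 * j₀ < 2 * M) :
    ‖aeval s b‖ = ρ ^ (d * μ + 2 * j₀) := by
  have hterm : ∀ j, j ≠ j₀ → ‖(b.coeff j : K) * s ^ j‖ ≤ ρ ^ (d * μ + 2 * j₀ + 1) := by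
    intro j hj
    rw [norm_mul, norm_pow, hs, ← pow_mul]
    have hle : ∀ {A : ℝ} {u : ℕ}, A ≤ ρ ^ u → d * μ + 2 * j₀ + 1 ≤ u + 2 * j →
        A * ρ ^ (2 * j) ≤ ρ ^ (d * μ + 2 * j₀ + 1) := by
      intro A u hA hu
      calc A * ρ ^ (2 * j) ≤ ρ ^ u * ρ ^ (2 * j) := by gcongr
        _ = ρ ^ (u + 2 * j) := by rw [pow_add]
        _ ≤ _ := pow_le_pow_of_le_one h0.le h1.le hu
    -- Below `j₀` an extra factor `r = ρ ^ d` wins, as `2 * j₀ < d`; between `j₀` and `M` the higher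
    -- power of `s` wins; from `M` on that power suffices by itself.
    rcases lt_or_ge j M with hjM | hjM
    · rcases lt_or_gt_of_ne hj with h | h
      · refine hle (u := d * (μ + 1)) ?_ (by rw [mul_add]; omega)
        rw [pow_mul, ← hr]
        exact hb' j h
      · refine hle (u := d * μ) ?_ (by omega)
        rw [pow_mul, ← hr]
        exact hb j hjM
    · refine hle (u := 0) ?_ (by omega)
      rw [pow_zero]
      exact IsUltrametricDist.norm_intCast_le_one K _
  have hmain : ‖(b.coeff j₀ : K) * s ^ j₀‖ = ρ ^ (d * μ + 2 * j₀) := by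
    rw [norm_mul, norm_pow, hs, hb₀, hr, ← pow_mul, ← pow_mul, ← pow_add]
  have hlt : ρ ^ (d * μ + 2 * j₀ + 1) < ρ ^ (d * μ + 2 * j₀) :=
    pow_lt_pow_right_of_lt_one₀ h0 h1 (Nat.lt_succ_self _)
  have hmem : j₀ ∈ Finset.range (b.natDegree + 1) := by
    rw [Finset.mem_range_succ_iff]
    refine le_natDegree_of_ne_zero fun h => ?_
    rw [h, Int.cast_zero, norm_zero, hr] at hb₀
    exact (pow_pos (pow_pos h0 _) _).ne hb₀
  have hsum : aeval s b = (b.coeff j₀ : K) * s ^ j₀ +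
      ∑ j ∈ (Finset.range (b.natDegree + 1)).erase j₀, (b.coeff j : K) * s ^ j := by
    rw [Finset.add_sum_erase _ (fun j => (b.coeff j : K) * s ^ j) hmem, aeval_eq_sum_range]
    simp [zsmul_eq_mul]
  have hrest : ‖∑ j ∈ (Finset.range (b.natDegree + 1)).erase j₀, (b.coeff j : K) * s ^ j‖ ≤
      ρ ^ (d * μ + 2 * j₀ + 1) :=
    IsUltrametricDist.norm_sum_le_of_forall_le_of_nonneg (pow_nonneg h0.le _)
      fun j hj => hterm j (Finset.ne_of_mem_erase hj)
  have hlt' := hrest.trans_lt (hmain ▸ hlt)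
  rw [hsum, IsUltrametricDist.norm_add_eq_max_of_norm_ne_norm hlt'.ne', max_eq_left hlt'.le, hmain]

end Ultrametric

/-! ### Compactness and valuations in the p-adic integers -/

namespace PadicInt

variable {p : ℕ} [hp : Fact p.Prime]

theorem norm_eq_inv_pow_valuation {x : ℤ_[p]} (hx : x ≠ 0) : ‖x‖ = (p : ℝ)⁻¹ ^ x.valuation := by
  rw [norm_eq_zpow_neg_valuation hx, zpow_neg, zpow_natCast, inv_pow]

theorem inv_pow_le_norm {x : ℤ_[p]} {n : ℕ} (h : (p : ℝ)⁻¹ ^ (n + 1) < ‖x‖) :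
    (p : ℝ)⁻¹ ^ n ≤ ‖x‖ := by
  have hx : x ≠ 0 := by
    rintro rfl
    rw [norm_zero] at h
    exact h.not_ge (by positivity)
  have h0 : (0 : ℝ) < (p : ℝ)⁻¹ := inv_pos.2 (by exact_mod_cast hp.out.pos)
  have h1 : (p : ℝ)⁻¹ < 1 := inv_lt_one_of_one_lt₀ (by exact_mod_cast hp.out.one_lt)
  rw [norm_eq_inv_pow_valuation hx] at h ⊢
  rw [pow_lt_pow_iff_right_of_lt_one₀ h0 h1] at h
  exact pow_le_pow_of_le_one h0.le h1.le (by omega)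

/-- A sequence of `p`-adic integers that is not identically zero attains its minimal valuation,
first at some index `j₀`. -/
theorem exists_first_min {x : ℕ → ℤ_[p]} (hx : x ≠ 0) :
    ∃ μ j₀ : ℕ, (∀ j, ‖x j‖ ≤ (p : ℝ)⁻¹ ^ μ) ∧ (∀ j < j₀, ‖x j‖ ≤ (p : ℝ)⁻¹ ^ (μ + 1)) ∧
      (p : ℝ)⁻¹ ^ (μ + 1) < ‖x j₀‖ := by
  classical
  have hex : ∃ μ, ∃ j, (p : ℝ)⁻¹ ^ (μ + 1) < ‖x j‖ := by
    obtain ⟨j, hj⟩ := Function.ne_iff.1 hx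
    obtain ⟨n, hn⟩ := exists_pow_lt_of_lt_one (norm_pos_iff.2 hj)
      (inv_lt_one_of_one_lt₀ (by exact_mod_cast hp.out.one_lt : (1 : ℝ) < p))
    refine ⟨n, j, lt_of_le_of_lt ?_ hn⟩
    exact pow_le_pow_of_le_one (by positivity)
      (inv_le_one_of_one_le₀ (by exact_mod_cast hp.out.one_lt.le)) (Nat.le_succ n)
  refine ⟨Nat.find hex, Nat.find (Nat.find_spec hex), fun j => ?_, fun j hj => ?_,
    Nat.find_spec (Nat.find_spec hex)⟩
  · have := fun m (hm : m < Nat.find hex) => Nat.find_min hex hm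
    generalize Nat.find hex = μ at this
    cases μ with
    | zero => simpa using norm_le_one (x j)
    | succ μ =>
      have := this μ (Nat.lt_succ_self μ)
      push Not at this
      exact this j
  · exact not_lt.1 (Nat.find_min (Nat.find_spec hex) hj)

/-- A sequence of integral polynomials has a `p`-adic power series as a cluster point. -/
theorem exists_cluster_coeff (h : ℕ → Polynomial ℤ) :
    ∃ x : ℕ → ℤ_[p], ∀ ε > 0, ∀ M m₀ : ℕ,
    ∃ m ≥ m₀, ∀ j < M, ‖((h m).coeff j : ℤ_[p]) - x j‖ < ε := by
  obtain ⟨x, -, hx⟩ := (isCompact_univ (X := ℕ → ℤ_[p])).exists_mapClusterPt_of_frequently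
    (l := atTop) (f := fun (m j : ℕ) => ((h m).coeff j : ℤ_[p]))
    (Frequently.of_forall fun _ => Set.mem_univ _)
  refine ⟨x, fun ε hε M m₀ => ?_⟩
  have hev : ∀ᶠ y in nhds x, ∀ j ∈ Finset.range M, ‖y j - x j‖ < ε := by
    rw [Filter.eventually_all_finset]
    intro j _
    have hc : Continuous fun y : ℕ → ℤ_[p] => ‖y j - x j‖ := by fun_prop
    exact hc.continuousAt.eventually_lt continuousAt_const (by simpa using hε)
  obtain ⟨m, hm, h⟩ := (frequently_atTop.1 (hx.frequently hev)) m₀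
  exact ⟨m, hm, fun j hj => h j (Finset.mem_range.2 hj)⟩

end PadicInt

namespace PadicAlgCl

variable {p : ℕ} [hp : Fact p.Prime]

theorem norm_intCast (z : ℤ) : ‖(z : PadicAlgCl p)‖ = ‖(z : ℤ_[p])‖ := by
  rw [PadicInt.norm_intCast_eq_padic_norm, ← PadicAlgCl.norm_extends]
  congr 1

theorem norm_natCast {n : ℕ} (hn : n ≠ 0) :
    ‖(n : PadicAlgCl p)‖ = (p : ℝ)⁻¹ ^ padicValNat p n := by
  have h := norm_intCast (p := p) (n : ℤ)
  rw [Int.cast_natCast, Int.cast_natCast] at h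
  have h0 : (n : ℚ_[p]) ≠ 0 := Nat.cast_ne_zero.2 hn
  rw [h, PadicInt.norm_def, PadicInt.coe_natCast, Padic.norm_eq_zpow_neg_valuation h0,
    Padic.valuation_natCast, zpow_neg, zpow_natCast, inv_pow]

end PadicAlgCl

/-! ### Valuation recursion and parity -/

namespace UnramifiedZpCovering

open Polynomial

variable {p : ℕ} [hp : Fact p.Prime] (T : UnramifiedZpCovering p)

/-- The `+ 1` on the left is the valuation of the vertex ratio `p`; the even term `2 * j₀` against
it is what makes $\lambda$ odd. -/
theorem exists_padicValNat_succ : ∃ μ j₀ k₀ : ℕ, 0 < j₀ ∧ ∀ k ≥ k₀,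
    padicValNat p (T.X (k + 1)).numSpanningTrees + 1 =
      padicValNat p (T.X k).numSpanningTrees + (p ^ (k + 1)).totient * μ + 2 * j₀ := by
  choose h hh0 hh using T.numSpanningTrees_succ (PadicAlgCl p)
  obtain ⟨x, hx⟩ := PadicInt.exists_cluster_coeff (p := p) h
  have hκ : ∀ k, (T.X k).numSpanningTrees ≠ 0 := fun k =>
    (SerreGraph.numSpanningTrees_pos (T.connected k)).ne'
  set r : ℝ := (p : ℝ)⁻¹ with hr
  have hr0 : 0 < r := inv_pos.2 (by exact_mod_cast hp.out.pos)
  have hr1 : r < 1 := inv_lt_one_of_one_lt₀ (by exact_mod_cast hp.out.one_lt)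
  have hpnorm : ‖(p : PadicAlgCl p)‖ = r := by
    rw [PadicAlgCl.norm_natCast hp.out.ne_zero, padicValNat_self, pow_one]
  have hroot : ∀ n, ∃ ζ : PadicAlgCl p, IsPrimitiveRoot ζ (p ^ n) := fun n =>
    have : NeZero ((p ^ n : ℕ) : PadicAlgCl p) := ⟨by exact_mod_cast pow_ne_zero _ hp.out.ne_zero⟩
    HasEnoughRootsOfUnity.exists_primitiveRoot (PadicAlgCl p) (p ^ n)
  choose ζ hζ using hroot
  have hne : ∀ n, p ^ n ≠ 0 := fun n => pow_ne_zero _ hp.out.ne_zero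
  set ρ : ℕ → ℝ := fun k => ‖ζ (k + 1) - 1‖ with hρ
  have hφ : ∀ k, (p ^ (k + 1)).totient ≠ 0 := fun k =>
    (Nat.totient_pos.2 (pow_pos hp.out.pos _)).ne'
  have hρr : ∀ k, r = ρ k ^ (p ^ (k + 1)).totient := fun k => by
    rw [hρ, (hζ (k + 1)).norm_sub_one_pow_totient, hpnorm]
  have hρ0 : ∀ k, 0 < ρ k := fun k => by
    refine lt_of_le_of_ne (norm_nonneg _) fun h0 => hr0.ne' ?_
    rw [hρr k, ← h0, zero_pow (hφ k)]
  have hρ1 : ∀ k, ρ k < 1 := fun k => by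
    by_contra hge
    exact hr1.not_ge (hρr k ▸ one_le_pow₀ (not_lt.1 hge))
  have hs : ∀ k, ∀ ξ ∈ primitiveRoots (p ^ (k + 1)) (PadicAlgCl p),
      ‖ξ + ξ⁻¹ - 2‖ = ρ k ^ 2 := by
    intro k ξ hξ
    have hξ' := isPrimitiveRoot_of_mem_primitiveRoots hξ
    rw [norm_add_inv_sub_two (hξ'.norm_eq_one_of_ne_zero (hne _)),
      hξ'.norm_sub_one_eq (hζ (k + 1)) (hne _)]
  have hcard : ∀ k, (primitiveRoots (p ^ (k + 1)) (PadicAlgCl p)).card = (p ^ (k + 1)).totient :=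
    fun k => (hζ (k + 1)).card_primitiveRoots
  -- Otherwise some `h m` would make `p` times the tree number of `T.X 1` smaller in norm than
  -- itself. Capping `ε` at `1` bounds a product of factors `≤ ε` by `ε`.
  have hxne : x ≠ 0 := by
    rintro rfl
    set c : ℝ := ‖(p * (T.X 1).numSpanningTrees : PadicAlgCl p)‖ with hc
    have hc0 : 0 < c := norm_pos_iff.2 (mul_ne_zero (Nat.cast_ne_zero.2 hp.out.ne_zero)
      (Nat.cast_ne_zero.2 (hκ 1)))
    set ε := min (c / 2) 1 with hε
    have hε0 : 0 < ε := lt_min (half_pos hc0) one_pos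
    obtain ⟨M, hM⟩ := exists_pow_lt_of_lt_one hε0 (hρ1 0)
    obtain ⟨m, hm1, hm⟩ := hx ε hε0 M 1
    have hval : ∀ ξ ∈ primitiveRoots (p ^ (0 + 1)) (PadicAlgCl p),
        ‖aeval (ξ + ξ⁻¹ - 2) (h m)‖ ≤ ε := by
      intro ξ hξ
      rw [aeval_eq_sum_range]
      refine IsUltrametricDist.norm_sum_le_of_forall_le_of_nonneg hε0.le fun j _ => ?_
      rw [zsmul_eq_mul, norm_mul, norm_pow, hs 0 ξ hξ]
      rcases lt_or_ge j M with hj | hj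
      · have h1 := hm j hj
        rw [Pi.zero_apply, sub_zero, ← PadicAlgCl.norm_intCast] at h1
        exact (mul_le_of_le_one_right (norm_nonneg _) (pow_le_one₀ (by positivity)
          (pow_le_one₀ (hρ0 0).le (hρ1 0).le))).trans h1.le
      · refine (mul_le_of_le_one_left (by positivity)
          (IsUltrametricDist.norm_intCast_le_one _ _)).trans (le_trans ?_ hM.le)
        rw [← pow_mul]
        exact pow_le_pow_of_le_one (hρ0 0).le (hρ1 0).le (by omega)
    have h1 := congrArg norm (hh m 0 (by omega))
    rw [norm_mul (((T.X 0).numSpanningTrees : ℕ) : PadicAlgCl p), norm_prod] at h1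
    have h2 : ∏ ξ ∈ primitiveRoots (p ^ (0 + 1)) (PadicAlgCl p),
        ‖aeval (ξ + ξ⁻¹ - 2) (h m)‖ ≤ ε := by
      refine (Finset.prod_le_prod (fun _ _ => norm_nonneg _) hval).trans ?_
      rw [Finset.prod_const, hcard]
      exact pow_le_of_le_one hε0.le (min_le_right _ _) (hφ 0)
    have h3 : c ≤ ε := by
      rw [hc]
      refine h1.le.trans ((mul_le_of_le_one_left (Finset.prod_nonneg fun _ _ => norm_nonneg _)
        ?_).trans h2)
      exact_mod_cast IsUltrametricDist.norm_natCast_le_one (PadicAlgCl p) _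
    have h4 : ε ≤ c / 2 := min_le_left _ _
    linarith
  obtain ⟨μ, j₀, hμ, hj, hj₀⟩ := PadicInt.exists_first_min hxne
  have hr' : ∀ n, 0 < r ^ n := fun n => pow_pos hr0 n
  have hj₀pos : 0 < j₀ := by
    rcases Nat.eq_zero_or_pos j₀ with rfl | h0
    · exfalso
      obtain ⟨m, -, hm⟩ := hx _ (hr' (μ + 1)) 1 0
      have := hm 0 one_pos
      rw [hh0, Int.cast_zero, zero_sub, norm_neg] at this
      exact lt_asymm this hj₀
    · exact h0
  -- This threshold gives `2 * j₀ ≤ k < p ^ k ≤ d`, as the dominance estimate requires.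
  refine ⟨μ, j₀, 2 * j₀, hj₀pos, fun k hk => ?_⟩
  set d := (p ^ (k + 1)).totient with hd
  have hdk : 2 * j₀ < d := by
    rw [hd, Nat.totient_prime_pow_succ hp.out]
    calc 2 * j₀ ≤ k := hk
      _ < p ^ k := Nat.lt_pow_self hp.out.one_lt
      _ ≤ p ^ k * (p - 1) := Nat.le_mul_of_pos_right _ (Nat.sub_pos_of_lt hp.out.one_lt)
  -- Precision `r ^ (μ + 1)` on these coefficients preserves both `μ` and `j₀`; `m > k` makes `h m`
  -- valid at level `k`.
  obtain ⟨m, hmk, hm⟩ := hx _ (hr' (μ + 1)) (d * μ + 2 * j₀ + 1) (k + 1)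
  have hle : ∀ n j, n ≤ μ + 1 → j < d * μ + 2 * j₀ + 1 → ‖x j‖ ≤ r ^ n →
      ‖((h m).coeff j : PadicAlgCl p)‖ ≤ r ^ n := by
    intro n j hn hjM hxj
    rw [PadicAlgCl.norm_intCast, ← sub_add_cancel (((h m).coeff j : ℤ) : ℤ_[p]) (x j)]
    refine (PadicInt.nonarchimedean _ _).trans (max_le ?_ hxj)
    exact (hm j hjM).le.trans (pow_le_pow_of_le_one hr0.le hr1.le hn)
  have hval : ∀ ξ ∈ primitiveRoots (p ^ (k + 1)) (PadicAlgCl p),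
      ‖aeval (ξ + ξ⁻¹ - 2) (h m)‖ = ρ k ^ (d * μ + 2 * j₀) := by
    intro ξ hξ
    refine norm_aeval_eq_of_dominant (hρ0 k) (hρ1 k) (hs k ξ hξ) (hρr k) (h m)
      (M := d * μ + 2 * j₀ + 1) (fun j hjM => hle μ j (Nat.le_succ μ) hjM (hμ j))
      (fun j hjj => hle (μ + 1) j le_rfl (by omega) (hj j hjj)) ?_ hdk
      ((Nat.lt_succ_self _).trans_le (Nat.le_mul_of_pos_left _ two_pos))
    refine le_antisymm (hle μ j₀ (Nat.le_succ μ) (by omega) (hμ j₀)) ?_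
    rw [PadicAlgCl.norm_intCast]
    refine PadicInt.inv_pow_le_norm (lt_of_not_ge fun hge => hj₀.not_ge ?_)
    rw [← sub_sub_cancel (((h m).coeff j₀ : ℤ) : ℤ_[p]) (x j₀), sub_eq_add_neg]
    refine (PadicInt.nonarchimedean _ _).trans (max_le hge ?_)
    rw [norm_neg]
    exact (hm j₀ (by omega)).le
  have h1 : ‖(p : PadicAlgCl p)‖ * ‖((T.X (k + 1)).numSpanningTrees : PadicAlgCl p)‖ =
      ‖((T.X k).numSpanningTrees : PadicAlgCl p)‖ * (ρ k ^ (d * μ + 2 * j₀)) ^ d := by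
    have h2 := congrArg norm (hh m k (by omega))
    rw [norm_mul, norm_mul, norm_prod] at h2
    refine h2.trans (congrArg _ ((Finset.prod_congr rfl hval).trans ?_))
    rw [Finset.prod_const, hcard]
  -- There are `d` factors of equal norm and `ρ k ^ d = r`, so the product has norm `r ^ (d * μ + 2
  -- * j₀)`.
  rw [← pow_mul, mul_comm (d * μ + 2 * j₀), pow_mul, ← hρr k, hpnorm,
    PadicAlgCl.norm_natCast (hκ _), PadicAlgCl.norm_natCast (hκ _), ← hr, ← pow_succ',
    ← pow_add] at h1
  rw [add_assoc (padicValNat p (T.X k).numSpanningTrees)]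
  exact pow_right_injective₀ hr0 hr1.ne h1

end UnramifiedZpCovering

/-- The second difference kills the linear part and forces `m = m'`; a first difference then
compares slopes. -/
theorem eq_of_eventually_linear_add_exp {p : ℕ} (hp : 1 < p) {l l' m m' ν ν' : ℤ}
    (h : ∀ᶠ n : ℕ in atTop, l * n + m * (p : ℤ) ^ n + ν = l' * n + m' * (p : ℤ) ^ n + ν') :
    l = l' := by
  obtain ⟨N, hN⟩ := eventually_atTop.1 h
  have h0 := hN N le_rfl
  have h1 := hN (N + 1) (by omega)
  have h2 := hN (N + 2) (by omega)
  push_cast at h0 h1 h2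
  rw [pow_succ] at h1
  rw [pow_add] at h2
  have hm : (m - m') * ((p : ℤ) - 1) ^ 2 * (p : ℤ) ^ N = 0 := by
    linear_combination h2 - 2 * h1 + h0
  have hp0 : (p : ℤ) ^ N ≠ 0 := pow_ne_zero _ (by exact_mod_cast (by omega : p ≠ 0))
  have hp1 : ((p : ℤ) - 1) ^ 2 ≠ 0 := pow_ne_zero _ (by
    have : (1 : ℤ) < p := by exact_mod_cast hp
    omega)
  have hmm : m - m' = 0 := by
    rcases mul_eq_zero.1 hm with h | h
    · exact (mul_eq_zero.1 h).resolve_right hp1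
    · exact absurd h hp0
  linear_combination h1 - h0 - hmm * (p : ℤ) ^ N * ((p : ℤ) - 1)

theorem proposition3p1 (p : ℕ) [Fact p.Prime] (T : UnramifiedZpCovering p) :
    (∃ l m : ℕ, T.HasIwasawaInvariants l m) ∧
      ∀ l m : ℕ, T.HasIwasawaInvariants l m → Odd l := by
  have hp : p.Prime := Fact.out
  obtain ⟨μ, j, k₀, hj, h⟩ := T.exists_padicValNat_succ
  have hinv : T.HasIwasawaInvariants (2 * j - 1) μ := by
    set v : ℕ → ℤ := fun n => padicValNat p (T.X n).numSpanningTrees with hv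
    -- Positivity of `j` keeps the natural subtraction from truncating.
    have hl : ((2 * j - 1 : ℕ) : ℤ) = 2 * j - 1 := by omega
    refine ⟨v k₀ - (2 * j - 1) * k₀ - μ * (p : ℤ) ^ k₀, ?_⟩
    filter_upwards [eventually_ge_atTop k₀] with n hn
    rw [hl]
    change v n = _
    induction n, hn using Nat.le_induction with
    | base => ring
    | succ n hn ih =>
      have h1 := h n hn
      -- The totient is `p ^ (n + 1) - p ^ n`, so the `μ` terms telescope.
      rw [Nat.totient_prime_pow_succ hp] at h1
      have h2 : v (n + 1) + 1 = v n + (p : ℤ) ^ n * (p - 1) * μ + 2 * j := by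
        have h3 : ((p - 1 : ℕ) : ℤ) = p - 1 := by
          have := hp.one_lt
          omega
        rw [← h3]
        simp only [hv]
        exact_mod_cast h1
      push_cast
      rw [pow_succ]
      linear_combination h2 + ih
  refine ⟨⟨_, _, hinv⟩, fun l m ⟨ν, hlm⟩ => ?_⟩
  obtain ⟨ν', hinv'⟩ := hinv
  have hl : (l : ℤ) = (2 * j - 1 : ℕ) := eq_of_eventually_linear_add_exp (m := m) (m' := μ) (ν := ν)
    (ν' := ν') hp.one_lt (by
    filter_upwards [hlm, hinv'] with n h1 h2
    rw [← h1, h2])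
  exact ⟨j - 1, by omega⟩
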